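/- Conventions. A finite-dimensional 2-Hilbert space $H$ is an abelian $\mathbb{C}$-linear category whose hom-spaces are finite-dimensional complex inner product spaces, with antilinear maps $*\colon \hom(x,y)\to\hom(y,x)$ satisfying $f^{**}=f$, $(fg)^*=g^*f^*$, $(fg,h)=(g,f^*h)$ and $(fg,h)=(f,hg^*)$, and with finitely many isomorphism classes of simple objects; $e_i$ denotes a choice of representatives of these and $k_i=(\mathrm{id}_{e_i},\mathrm{id}_{e_i})$. The 2-category $2\mathcal{H}ilb$ has these as objects, linear $*$-functors as 1-morphisms and natural transformations as 2-morphisms. The space $\mathrm{Nat}(F,F')$ of natural transformations carries the inner product $\langle\theta,\theta'\rangle=\sum_i k_i(\theta_{e_i},\theta'_{e_i})$. An ambidextrous adjoint $\langle F^*\rangle$ of a 1-morphism $F\colon H\to H'$ is a 1-morphism $F^*\colon H'\to H$ with a unit and counit exhibiting $F\dashv F^*$ and a unit and counit exhibiting $F^*\dashv F$. It is even-handed (for the canonical even-handed structure of $2\mathcal{H}ilb$) if the adjunction isomorphisms $\varphi\colon\mathrm{Hom}(Fx,y)\to\mathrm{Hom}(x,F^*y)$ and $\psi\colon\mathrm{Hom}(F^*y,x)\to\mathrm{Hom}(y,Fx)$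 satisfy $\psi=*\,\varphi^{*}\,*$, where $\varphi^*$ is the Hilbert space adjoint of $\varphi$. Let $G$ be a finite group. A unitary 2-representation $\alpha$ of $G$ consists of a finite-dimensional 2-Hilbert space $H_\alpha$, linear $*$-functors $\alpha_g\colon H_\alpha\to H_\alpha$ ($g\in G$) that are unitary on hom-spaces, and unitary natural isomorphisms $\phi(e)\colon\mathrm{id}\Rightarrow\alpha_e$, $\phi(g_2,g_1)\colon\alpha_{g_2}\alpha_{g_1}\Rightarrow\alpha_{g_2g_1}$ satisfying the usual unit and associativity coherence equations. A morphism $\sigma\colon\alpha\to\beta$ is a linear $*$-functor $\sigma\colon H_\alpha\to H_\beta$ with unitary natural isomorphisms $\sigma(g)\colon\beta_g\sigma\Rightarrow\sigma\alpha_g$ compatible with the coherence isomorphisms of $\alpha$ and $\beta$. A 2-morphism $\theta\colon\sigma\Rightarrow\rho$ is a natural transformation with $(\theta*\mathrm{id})\circ\sigma(g)=\rho(g)\circ(\mathrm{id}*\theta)$ for all $g$. Morphisms compose in the usual way, and $[2\mathcal{R}ep(G)]$ is the category whose objects are the unitary 2-representations of $G$ and whose morphisms are the isomorphism classes of morphisms.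 A unitary equivariant vector bundle over $G$ consists of finite-dimensional Hilbert spaces $E_x$ ($x\in G$) and unitary maps $E(gxg^{-1}\xleftarrow{g}x)\colon E_x\to E_{gxg^{-1}}$ that are functorial in $g$. A morphism is a family of linear maps $E_x\to E'_x$ commuting with these maps. This gives the category $\mathrm{Hilb}_G(G)$. The 2-character $\chi_\alpha$ has fibres $\chi_\alpha(x)=\mathrm{Nat}(\mathrm{id}_{H_\alpha},\alpha_x)$, and $\chi_\alpha(gxg^{-1}\xleftarrow{g}x)$ sends $\theta$ to the composite $$\mathrm{id}\xrightarrow{\phi(e)}\alpha_e\xrightarrow{\phi(g,g^{-1})^{-1}}\alpha_g\alpha_{g^{-1}}\xrightarrow{\alpha_g\theta\alpha_{g^{-1}}}\alpha_g\alpha_x\alpha_{g^{-1}}\xrightarrow{\phi(g,x)}\alpha_{gx}\alpha_{g^{-1}}\xrightarrow{\phi(gx,g^{-1})}\alpha_{gxg^{-1}}.$$ For a morphism $\sigma\colon\alpha\to\beta$ and an even-handed ambidextrous adjoint $\langle\sigma^*\rangle$ of the functor $\sigma$, let $n\colon\mathrm{id}\Rightarrow\sigma\sigma^*$ be the unit of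 $\sigma^*\dashv\sigma$ and $\epsilon\colon\sigma\sigma^*\Rightarrow\mathrm{id}$ the counit of $\sigma\dashv\sigma^*$. The linear map $\chi(\sigma)_x\colon\chi_\alpha(x)\to\chi_\beta(x)$ sends $\theta$ to the composite $$\mathrm{id}\xrightarrow{n}\sigma\sigma^*\xrightarrow{\sigma\theta\sigma^*}\sigma\alpha_x\sigma^*\xrightarrow{\sigma(x)^{-1}\sigma^*}\beta_x\sigma\sigma^*\xrightarrow{\beta_x\epsilon}\beta_x.$$ Theorem. Let $G$ be a finite group. Every $\chi_\alpha$ is a unitary equivariant vector bundle over $G$, and every morphism $\sigma$ of unitary 2-representations of $G$ has an even-handed ambidextrous adjoint. The map $\chi(\sigma)=(\chi(\sigma)_x)_{x\in G}\colon\chi_\alpha\to\chi_\beta$ (i) does not depend on the choice of the even-handed ambidextrous adjoint $\langle\sigma^*\rangle$; (ii) is a morphism of equivariant vector bundles over $G$; (iii) depends only on the isomorphism class of $\sigma$: if $\sigma\cong\rho$ by an invertible 2-morphism, then $\chi(\sigma)=\chi(\rho)$; (iv) is functorial: $\chi(\mathrm{id}_\alpha)=\mathrm{id}$ and $\chi(\delta\circ\sigma)=\chi(\delta)\circ\chi(\sigma)$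 for $\sigma\colon\alpha\to\beta$ and $\delta\colon\beta\to\gamma$. Hence $\alpha\mapsto\chi_\alpha$, $[\sigma]\mapsto\chi(\sigma)$ is a functor $\chi\colon[2\mathcal{R}ep(G)]\to\mathrm{Hilb}_G(G)$. -/

import Mathlib

open CategoryTheory

universe v u w

set_option linter.checkUnivs false

/-! ### 2-Hilbert spaces -/

/-- The structure making an abelian `ℂ`-linear category `H` a (finite-dimensional) 2-Hilbert space:
the hom-spaces are finite-dimensional Hilbert spaces (inner products are conjugate-linear in the
first variable), there is an antilinear involution `f ↦ f†` on morphisms compatible with composition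
and with the inner products, and there are only finitely many isomorphism classes of simple objects.
Recall that `g ≫ f` is the composite `f ∘ g`. -/
class TwoHilbertSpace (H : Type u) [Category.{v} H] [Abelian H] [Linear ℂ H] where
  homInner : ∀ x y : H, InnerProductSpace.Core ℂ (x ⟶ y)
  homFinite : ∀ x y : H, FiniteDimensional ℂ (x ⟶ y)
  dagger : ∀ {x y : H}, (x ⟶ y) → (y ⟶ x)
  dagger_add : ∀ {x y : H} (f g : x ⟶ y), dagger (f + g) = dagger f + dagger g
  dagger_smul : ∀ {x y : H} (c : ℂ) (f : x ⟶ y),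
    dagger (c • f) = (starRingEnd ℂ) c • dagger f
  dagger_dagger : ∀ {x y : H} (f : x ⟶ y), dagger (dagger f) = f
  dagger_comp : ∀ {x y z : H} (g : x ⟶ y) (f : y ⟶ z), dagger (g ≫ f) = dagger f ≫ dagger g
  /-- `(f ∘ g, h) = (g, f† ∘ h)` -/
  inner_comp_left : ∀ {x y z : H} (g : x ⟶ y) (f : y ⟶ z) (h : x ⟶ z),
    (homInner x z).inner (g ≫ f) h = (homInner x y).inner g (h ≫ dagger f)
  /-- `(f ∘ g, h) = (f, h ∘ g†)` -/
  inner_comp_right : ∀ {x y z : H} (g : x ⟶ y) (f : y ⟶ z) (h : x ⟶ z),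
    (homInner x z).inner (g ≫ f) h = (homInner y z).inner f (dagger g ≫ h)
  finite_simples : ∃ (n : ℕ) (e : Fin n → H), ∀ s : H, Simple s → ∃ i, Nonempty (s ≅ e i)

/-- A finite-dimensional 2-Hilbert space, bundled: the objects of the 2-category `2Hilb`. -/
structure TwoHilb where
  carrier : Type u
  [cat : Category.{v} carrier]
  [abelian : Abelian carrier]
  [linear : Linear ℂ carrier]
  [hilb : TwoHilbertSpace carrier]

namespace TwoHilb

instance : CoeSort TwoHilb.{v, u} (Type u) := ⟨TwoHilb.carrier⟩

attribute [instance] TwoHilb.cat TwoHilb.abelian TwoHilb.linear TwoHilb.hilb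

/-- The inner product on a hom-space of a 2-Hilbert space. -/
noncomputable def inn {H : TwoHilb.{v, u}} {x y : H} (f g : x ⟶ y) : ℂ :=
  (TwoHilbertSpace.homInner x y).inner f g

/-- The antilinear involution `* : hom(x, y) → hom(y, x)`. -/
def dag {H : TwoHilb.{v, u}} {x y : H} (f : x ⟶ y) : y ⟶ x := TwoHilbertSpace.dagger f

/-- Unitary morphisms: `f† ∘ f = id` and `f ∘ f† = id`. -/
def IsUnitary {H : TwoHilb.{v, u}} {x y : H} (f : x ⟶ y) : Prop :=
  f ≫ dag f = 𝟙 x ∧ dag f ≫ f = 𝟙 y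

/-- The simple objects of `H`. -/
def SimpleObj (H : TwoHilb.{v, u}) : Type u := {e : H // Simple e}

/-- Two simple objects are equivalent when they are isomorphic. -/
instance simpleSetoid (H : TwoHilb.{v, u}) : Setoid (SimpleObj H) where
  r a b := Nonempty (a.1 ≅ b.1)
  iseqv := ⟨fun a => ⟨Iso.refl a.1⟩, fun ⟨i⟩ => ⟨i.symm⟩, fun ⟨i⟩ ⟨j⟩ => ⟨i ≪≫ j⟩⟩

/-- The index set of isomorphism classes of simple objects. -/
def SimpleClass (H : TwoHilb.{v, u}) : Type u := Quotient (simpleSetoid H)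

/-- A choice of simple object `e_i` in each isomorphism class. -/
noncomputable def simpleRep {H : TwoHilb.{v, u}} (i : SimpleClass H) : H :=
  (Quotient.out i : SimpleObj H).1

/-- The scale factor `k_i = (id_{e_i}, id_{e_i})`. -/
noncomputable def scale {H : TwoHilb.{v, u}} (i : SimpleClass H) : ℂ :=
  inn (𝟙 (simpleRep i)) (𝟙 (simpleRep i))

/-- There are finitely many isomorphism classes of simple objects. -/
theorem finite_simpleClass (H : TwoHilb.{v, u}) : Finite (SimpleClass H) := by
  obtain ⟨n, e, he⟩ := TwoHilbertSpace.finite_simples (H := H.carrier)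
  choose c hc using fun i : SimpleClass H => he (simpleRep i) (Quotient.out i : SimpleObj H).2
  refine Finite.of_injective c fun i j hij => ?_
  obtain ⟨a⟩ := hc i
  obtain ⟨b⟩ := hc j
  rw [← Quotient.out_eq i, ← Quotient.out_eq j]
  exact Quotient.sound ⟨a ≪≫ eqToIso (by rw [hij]) ≪≫ b.symm⟩

noncomputable instance (H : TwoHilb.{v, u}) : Fintype (SimpleClass H) :=
  @Fintype.ofFinite _ (finite_simpleClass H)

/-- The inner product `⟨θ, θ'⟩ = ∑ i, k_i (θ_{e_i}, θ'_{e_i})` on the space of natural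
transformations between functors of 2-Hilbert spaces. -/
noncomputable def natInner {H H' : TwoHilb.{v, u}} {F F' : H ⥤ H'} (θ θ' : F ⟶ F') : ℂ :=
  ∑ i : SimpleClass H, scale i * inn (θ.app (simpleRep i)) (θ'.app (simpleRep i))

end TwoHilb

open TwoHilb

/-- Linear `*`-functors between 2-Hilbert spaces: the 1-morphisms of `2Hilb`. (A functor which is
additive on hom-spaces preserves direct sums.) The 2-morphisms of `2Hilb` are the natural
transformations of the underlying functors. -/
structure LinStarFunctor (H H' : TwoHilb.{v, u}) where
  functor : H ⥤ H'
  additive : functor.Additive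
  linear : functor.Linear ℂ
  map_dag : ∀ {x y : H} (f : x ⟶ y), functor.map (dag f) = dag (functor.map f)

namespace LinStarFunctor

attribute [instance] LinStarFunctor.additive LinStarFunctor.linear

/-- The identity 1-morphism. -/
@[reducible]
def id (H : TwoHilb.{v, u}) : LinStarFunctor H H where
  functor := 𝟭 H
  additive := inferInstance
  linear := inferInstance
  map_dag _ := rfl

/-- Composition of 1-morphisms: `F.comp F'` is `F' ∘ F`. -/
@[reducible]
def comp {H H' H'' : TwoHilb.{v, u}} (F : LinStarFunctor H H') (F' : LinStarFunctor H' H'') :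
    LinStarFunctor H H'' where
  functor := F.functor ⋙ F'.functor
  additive := inferInstance
  linear := inferInstance
  map_dag f := by simp [F.map_dag, F'.map_dag]

end LinStarFunctor

/-! ### Ambidextrous adjoints and the canonical even-handed structure of `2Hilb` -/

/-- An ambidextrous adjoint of `F` in `2Hilb`: a 1-morphism `F*` in the opposite direction together
with a unit and a counit exhibiting `F*` as a right adjoint of `F`, and a unit and a counit
exhibiting `F*` as a left adjoint of `F`. -/
structure AmbiAdjoint {H H' : TwoHilb.{v, u}} (F : LinStarFunctor H H') where
  adjoint : LinStarFunctor H' H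
  asRight : F.functor ⊣ adjoint.functor
  asLeft : adjoint.functor ⊣ F.functor

/-- The ambidextrous adjoint is even-handed for the canonical even-handed structure of `2Hilb`:
writing `φ : Hom(F x, y) ≅ Hom(x, F* y)` and `ψ : Hom(F* y, x) ≅ Hom(y, F x)` for the two
adjunction isomorphisms, `ψ = * ∘ φ^* ∘ *` where `φ^*` is the Hilbert space adjoint of `φ`.
That is, `φ^* = * ∘ ψ ∘ *`, i.e. `(φ f, g†) = (f, (ψ g)†)` for all `f` and `g`. -/
def AmbiAdjoint.IsEvenHanded {H H' : TwoHilb.{v, u}} {F : LinStarFunctor H H'}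
    (A : AmbiAdjoint F) : Prop :=
  ∀ (x : H) (y : H') (f : F.functor.obj x ⟶ y) (g : A.adjoint.functor.obj y ⟶ x),
    inn (A.asRight.homEquiv x y f) (dag g) = inn f (dag (A.asLeft.homEquiv y x g))

/-! ### Unitary 2-representations, their morphisms and 2-morphisms -/

/-- A unitary 2-representation of `G`. -/
structure TwoRep (G : Type w) [Group G] where
  space : TwoHilb.{v, u}
  /-- the linear `*`-functors `α_g` -/
  act : G → LinStarFunctor space space
  /-- `α_g` is a unitary linear map on hom-spaces: it preserves inner products and is onto -/
  act_inner : ∀ (g : G) {x y : space} (f f' : x ⟶ y),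
    inn ((act g).functor.map f) ((act g).functor.map f') = inn f f'
  act_surjective : ∀ (g : G) (x y : space),
    Function.Surjective (fun f : x ⟶ y => (act g).functor.map f)
  /-- `φ(e) : id ⇒ α_e` -/
  unitIso : 𝟭 space ≅ (act 1).functor
  /-- `φ(g₂, g₁) : α_{g₂} ∘ α_{g₁} ⇒ α_{g₂ g₁}` -/
  mulIso : ∀ g₂ g₁ : G, (act g₁).functor ⋙ (act g₂).functor ≅ (act (g₂ * g₁)).functor
  unit_unitary : ∀ x : space, IsUnitary (unitIso.hom.app x)
  mul_unitary : ∀ (g₂ g₁ : G) (x : space), IsUnitary ((mulIso g₂ g₁).hom.app x)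
  /-- `φ(e, g) ∘ (φ(e) ∗ id) = id` -/
  unit_mul : ∀ (g : G) (x : space),
    unitIso.hom.app ((act g).functor.obj x) ≫ (mulIso 1 g).hom.app x =
      eqToHom (by rw [one_mul]; rfl)
  /-- `φ(g, e) ∘ (id ∗ φ(e)) = id` -/
  mul_unit : ∀ (g : G) (x : space),
    (act g).functor.map (unitIso.hom.app x) ≫ (mulIso g 1).hom.app x =
      eqToHom (by rw [mul_one]; rfl)
  /-- `φ(g₃ g₂, g₁) ∘ (φ(g₃, g₂) ∗ id) = φ(g₃, g₂ g₁) ∘ (id ∗ φ(g₂, g₁))` -/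
  mul_assoc : ∀ (g₃ g₂ g₁ : G) (x : space),
    (mulIso g₃ g₂).hom.app ((act g₁).functor.obj x) ≫ (mulIso (g₃ * g₂) g₁).hom.app x =
      (act g₃).functor.map ((mulIso g₂ g₁).hom.app x) ≫ (mulIso g₃ (g₂ * g₁)).hom.app x ≫
        eqToHom (by rw [_root_.mul_assoc])

/-- A morphism `σ : α → β` of unitary 2-representations. -/
structure TwoRepHom {G : Type w} [Group G] (α β : TwoRep.{v, u} G) where
  /-- the underlying linear `*`-functor -/
  base : LinStarFunctor α.space β.space
  /-- `σ(g) : β_g ∘ σ ⇒ σ ∘ α_g` -/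
  iso : ∀ g : G, base.functor ⋙ (β.act g).functor ≅ (α.act g).functor ⋙ base.functor
  iso_unitary : ∀ (g : G) (x : α.space), IsUnitary ((iso g).hom.app x)
  /-- `σ(g₂ g₁) ∘ (ψ(g₂, g₁) ∗ id) = (id ∗ φ(g₂, g₁)) ∘ (σ(g₂) ∗ id) ∘ (id ∗ σ(g₁))` -/
  mul_compat : ∀ (g₂ g₁ : G) (x : α.space),
    (β.mulIso g₂ g₁).hom.app (base.functor.obj x) ≫ (iso (g₂ * g₁)).hom.app x =
      (β.act g₂).functor.map ((iso g₁).hom.app x) ≫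
        (iso g₂).hom.app ((α.act g₁).functor.obj x) ≫
          base.functor.map ((α.mulIso g₂ g₁).hom.app x)
  /-- `σ(e) ∘ (ψ(e) ∗ id) = id ∗ φ(e)` -/
  unit_compat : ∀ x : α.space,
    β.unitIso.hom.app (base.functor.obj x) ≫ (iso 1).hom.app x =
      base.functor.map (α.unitIso.hom.app x)

/-- A 2-morphism `θ : σ ⇒ ρ`: a natural transformation with
`(θ ∗ id) ∘ σ(g) = ρ(g) ∘ (id ∗ θ)`. -/
@[ext]
structure TwoRepModification {G : Type w} [Group G] {α β : TwoRep.{v, u} G}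
    (σ ρ : TwoRepHom α β) where
  nat : σ.base.functor ⟶ ρ.base.functor
  comm : ∀ (g : G) (x : α.space),
    (σ.iso g).hom.app x ≫ nat.app ((α.act g).functor.obj x) =
      (β.act g).functor.map (nat.app x) ≫ (ρ.iso g).hom.app x

/-- The category of morphisms `α → β` and 2-morphisms between them. -/
@[simps]
instance TwoRepHom.category {G : Type w} [Group G] (α β : TwoRep.{v, u} G) :
    Category (TwoRepHom α β) where
  Hom σ ρ := TwoRepModification σ ρ
  id σ := ⟨𝟙 _, fun g x => by simp⟩
  comp θ θ' := ⟨θ.nat ≫ θ'.nat, fun g x => by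
    simp only [NatTrans.comp_app, Functor.map_comp, Category.assoc]
    rw [← Category.assoc, θ.comm, Category.assoc, θ'.comm]⟩
  id_comp _ := TwoRepModification.ext (Category.id_comp _)
  comp_id _ := TwoRepModification.ext (Category.comp_id _)
  assoc _ _ _ := TwoRepModification.ext (Category.assoc _ _ _)

namespace TwoHilb

theorem IsUnitary.id {H : TwoHilb.{v, u}} (x : H) : IsUnitary (𝟙 x) := by
  have h : dag (𝟙 x) = 𝟙 x := by
    have h1 := TwoHilbertSpace.dagger_comp (dag (𝟙 x)) (𝟙 x)
    rw [Category.comp_id] at h1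
    simp only [dag, TwoHilbertSpace.dagger_dagger, Category.comp_id] at h1 ⊢
    exact h1.symm
  simp [IsUnitary, h]

theorem IsUnitary.comp {H : TwoHilb.{v, u}} {x y z : H} {f : x ⟶ y} {g : y ⟶ z}
    (hf : IsUnitary f) (hg : IsUnitary g) : IsUnitary (f ≫ g) := by
  have h : dag (f ≫ g) = dag g ≫ dag f := TwoHilbertSpace.dagger_comp f g
  constructor
  · rw [h, Category.assoc, ← Category.assoc g, hg.1, Category.id_comp, hf.1]
  · rw [h, Category.assoc, ← Category.assoc (dag f), hf.2, Category.id_comp, hg.2]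

theorem IsUnitary.map {H H' : TwoHilb.{v, u}} (F : LinStarFunctor H H') {x y : H} {f : x ⟶ y}
    (hf : IsUnitary f) : IsUnitary (F.functor.map f) := by
  constructor
  · rw [← F.map_dag, ← Functor.map_comp, hf.1, CategoryTheory.Functor.map_id]
  · rw [← F.map_dag, ← Functor.map_comp, hf.2, CategoryTheory.Functor.map_id]

end TwoHilb

namespace TwoRepHom

variable {G : Type w} [Group G]

/-- The identity morphism of a unitary 2-representation. -/
@[reducible]
def id (α : TwoRep.{v, u} G) : TwoRepHom α α where
  base := LinStarFunctor.id α.space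
  iso g := Functor.leftUnitor _ ≪≫ (Functor.rightUnitor _).symm
  iso_unitary g x := by simpa using IsUnitary.id _
  mul_compat g₂ g₁ x := by simp
  unit_compat x := by simp

/-- The composite `δ ∘ σ` of morphisms `σ : α → β` and `δ : β → γ`, with coherence isomorphisms
`γ_g ∘ δ ∘ σ ⇒ δ ∘ β_g ∘ σ ⇒ δ ∘ σ ∘ α_g`. -/
@[reducible]
def comp {α β γ : TwoRep.{v, u} G} (σ : TwoRepHom α β) (δ : TwoRepHom β γ) : TwoRepHom α γ where
  base := σ.base.comp δ.base
  iso g := NatIso.ofComponents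
    (fun x => (δ.iso g).app (σ.base.functor.obj x) ≪≫ δ.base.functor.mapIso ((σ.iso g).app x))
    (fun {x y} f => by
      have h1 := (δ.iso g).hom.naturality (σ.base.functor.map f)
      have h2 := (σ.iso g).hom.naturality f
      simp only [Functor.comp_map] at h1 h2
      simp only [Functor.comp_map, Iso.trans_hom, Iso.app_hom,
        Functor.mapIso_hom, Category.assoc]
      rw [← Category.assoc, h1, Category.assoc, ← Functor.map_comp, h2, Functor.map_comp])
  iso_unitary g x := by
    simpa using (δ.iso_unitary g _).comp ((σ.iso_unitary g x).map δ.base)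
  mul_compat g₂ g₁ x := by
    have h1 := δ.mul_compat g₂ g₁ (σ.base.functor.obj x)
    have h2 := congrArg δ.base.functor.map (σ.mul_compat g₂ g₁ x)
    have h3 := (δ.iso g₂).hom.naturality ((σ.iso g₁).hom.app x)
    simp only [Functor.comp_map, Functor.map_comp, Functor.comp_obj] at h1 h2 h3
    simp only [Functor.comp_obj, Functor.comp_map,
      NatIso.ofComponents_hom_app, Iso.trans_hom, Iso.app_hom, Functor.mapIso_hom,
      Functor.map_comp, Category.assoc]
    rw [← Category.assoc, h1]
    simp only [Category.assoc]
    rw [h2, reassoc_of% h3]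
  unit_compat x := by
    have h1 := δ.unit_compat (σ.base.functor.obj x)
    have h2 := congrArg δ.base.functor.map (σ.unit_compat x)
    simp only [Functor.map_comp] at h2
    simp only [Functor.comp_obj, Functor.comp_map,
      NatIso.ofComponents_hom_app, Iso.trans_hom, Iso.app_hom, Functor.mapIso_hom]
    rw [← Category.assoc, h1, h2]

@[simp] theorem id_iso_hom_app (α : TwoRep.{v, u} G) (g : G) (x : α.space) :
    ((id α).iso g).hom.app x = 𝟙 _ := by simp [id]

@[simp] theorem comp_iso_hom_app {α β γ : TwoRep.{v, u} G} (σ : TwoRepHom α β)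
    (δ : TwoRepHom β γ) (g : G) (x : α.space) :
    ((σ.comp δ).iso g).hom.app x =
      (δ.iso g).hom.app (σ.base.functor.obj x) ≫ δ.base.functor.map ((σ.iso g).hom.app x) := rfl

/-- Horizontal composition of 2-morphisms. -/
def hcomp {α β γ : TwoRep.{v, u} G} {σ σ' : TwoRepHom α β} {δ δ' : TwoRepHom β γ}
    (θ : σ ⟶ σ') (κ : δ ⟶ δ') : σ.comp δ ⟶ σ'.comp δ' where
  nat := NatTrans.hcomp (TwoRepModification.nat θ) (TwoRepModification.nat κ)
  comm g x := by
    have h1 := TwoRepModification.comm θ g x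
    have h2 := TwoRepModification.comm κ g (σ.base.functor.obj x)
    have h3 := (δ'.iso g).hom.naturality ((TwoRepModification.nat θ).app x)
    have h4 := (TwoRepModification.nat κ).naturality ((σ.iso g).hom.app x)
    have h5 := congrArg δ'.base.functor.map h1
    simp only [Functor.comp_map, Functor.map_comp, Functor.comp_obj] at h1 h2 h3 h4 h5
    simp only [NatIso.ofComponents_hom_app, Iso.trans_hom, Iso.app_hom, Functor.mapIso_hom,
      NatTrans.hcomp_app,
      Functor.comp_obj, Functor.comp_map, Functor.map_comp, Category.assoc]
    rw [reassoc_of% h4, reassoc_of% h2, h5, reassoc_of% h3]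

/-- Isomorphic morphisms have isomorphic composites. -/
theorem comp_congr {α β γ : TwoRep.{v, u} G} {σ σ' : TwoRepHom α β} {δ δ' : TwoRepHom β γ}
    (i : σ ≅ σ') (j : δ ≅ δ') : Nonempty (σ.comp δ ≅ σ'.comp δ') := by
  have hi1 := fun x => congrArg (fun t : TwoRepModification _ _ => t.nat.app x) i.hom_inv_id
  have hi2 := fun x => congrArg (fun t : TwoRepModification _ _ => t.nat.app x) i.inv_hom_id
  have hj1 := fun x => congrArg (fun t : TwoRepModification _ _ => t.nat.app x) j.hom_inv_id
  have hj2 := fun x => congrArg (fun t : TwoRepModification _ _ => t.nat.app x) j.inv_hom_id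
  simp only [TwoRepHom.category_comp_nat, TwoRepHom.category_id_nat, NatTrans.comp_app,
    NatTrans.id_app] at hi1 hi2 hj1 hj2
  refine ⟨⟨hcomp i.hom j.hom, hcomp i.inv j.inv, ?_, ?_⟩⟩
  · refine TwoRepModification.ext (NatTrans.ext (funext fun x => ?_))
    simp [hcomp, ← Functor.map_comp, hi1, hj1]
  · refine TwoRepModification.ext (NatTrans.ext (funext fun x => ?_))
    simp [hcomp, ← Functor.map_comp, hi2, hj2]

/-- An invertible 2-morphism from the identity natural transformation, when two morphisms have the
same underlying functor and the same coherence isomorphisms. -/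
def isoOfEq {α β : TwoRep.{v, u} G} {σ ρ : TwoRepHom α β}
    (t : σ.base.functor ≅ ρ.base.functor)
    (h : ∀ (g : G) (x : α.space),
      (σ.iso g).hom.app x ≫ t.hom.app ((α.act g).functor.obj x) =
        (β.act g).functor.map (t.hom.app x) ≫ (ρ.iso g).hom.app x) : σ ≅ ρ where
  hom := ⟨t.hom, h⟩
  inv := ⟨t.inv, fun g x => by
    rw [← cancel_mono (t.hom.app ((α.act g).functor.obj x)), Category.assoc,
      Category.assoc, h, ← Category.assoc ((β.act g).functor.map _),
      ← CategoryTheory.Functor.map_comp]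
    simp⟩
  hom_inv_id := TwoRepModification.ext t.hom_inv_id
  inv_hom_id := TwoRepModification.ext t.inv_hom_id

end TwoRepHom

/-- The objects of the homotopy category `[2Rep(G)]`: unitary 2-representations of `G`. -/
structure HoTwoRep (G : Type w) [Group G] where
  rep : TwoRep.{v, u} G

/-- The homotopy category `[2Rep(G)]`: its morphisms are the isomorphism classes of morphisms of
unitary 2-representations. -/
instance HoTwoRep.category (G : Type w) [Group G] : Category (HoTwoRep.{v, u} G) where
  Hom a b := Quotient (isIsomorphicSetoid (TwoRepHom a.rep b.rep))
  id a := Quotient.mk _ (TwoRepHom.id a.rep)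
  comp {a b c} f g := Quotient.liftOn₂ f g
    (fun σ δ => Quotient.mk (isIsomorphicSetoid (TwoRepHom a.rep c.rep)) (σ.comp δ))
    (fun _ _ _ _ h h' => Quotient.sound
      (TwoRepHom.comp_congr (Classical.choice h) (Classical.choice h')))
  id_comp := by
    rintro a b ⟨σ⟩
    exact Quotient.sound ⟨TwoRepHom.isoOfEq (Functor.leftUnitor _) fun g x => by simp⟩
  comp_id := by
    rintro a b ⟨σ⟩
    exact Quotient.sound ⟨TwoRepHom.isoOfEq (Functor.rightUnitor _) fun g x => by simp⟩
  assoc := by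
    rintro a b c d ⟨σ⟩ ⟨δ⟩ ⟨ε⟩
    exact Quotient.sound ⟨TwoRepHom.isoOfEq (Functor.associator _ _ _) fun g x => by simp⟩

/-- The class in `[2Rep(G)]` of a morphism of unitary 2-representations. -/
def HoTwoRep.homMk {G : Type w} [Group G] {α β : TwoRep.{v, u} G} (σ : TwoRepHom α β) :
    (⟨α⟩ : HoTwoRep.{v, u} G) ⟶ ⟨β⟩ :=
  Quotient.mk (isIsomorphicSetoid (TwoRepHom α β)) σ

/-! ### Equivariant vector bundles over the group -/

/-- The data of an equivariant vector bundle over `G` equipped with a form on each fibre: a complex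
vector space `E_x` for each `x : G`, a form on `E_x`, and a linear map `E_x → E_y` for every
morphism `g : x → y` of the loop groupoid of `G`, that is for all `g, x, y` with `y = g x g⁻¹`. -/
structure BundleData (G : Type w) [Group G] where
  fiber : G → Type u
  [addCommGroup : ∀ x, AddCommGroup (fiber x)]
  [module : ∀ x, Module ℂ (fiber x)]
  form : ∀ x, fiber x → fiber x → ℂ
  act : ∀ (g : G) {x y : G}, y = g * x * g⁻¹ → (fiber x →ₗ[ℂ] fiber y)

namespace BundleData

attribute [instance] BundleData.addCommGroup BundleData.module

/-- The data form a unitary equivariant vector bundle, i.e. a functor from the loop groupoid to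
finite-dimensional Hilbert spaces which sends every morphism to a unitary map (each `act g` is
invertible by functoriality). -/
structure IsUnitaryBundle {G : Type w} [Group G] (E : BundleData.{u} G) : Prop where
  finite : ∀ x, FiniteDimensional ℂ (E.fiber x)
  inner : ∀ x, ∃ c : InnerProductSpace.Core ℂ (E.fiber x), ∀ s t, c.inner s t = E.form x s t
  act_one : ∀ (x : G) (h : x = 1 * x * 1⁻¹), E.act 1 h = LinearMap.id
  act_mul : ∀ (g₂ g₁ x y z : G) (h₁ : y = g₁ * x * g₁⁻¹) (h₂ : z = g₂ * y * g₂⁻¹)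
    (h : z = g₂ * g₁ * x * (g₂ * g₁)⁻¹), E.act (g₂ * g₁) h = E.act g₂ h₂ ∘ₗ E.act g₁ h₁
  act_form : ∀ (g x y : G) (h : y = g * x * g⁻¹) (s t : E.fiber x),
    E.form y (E.act g h s) (E.act g h t) = E.form x s t

end BundleData

/-- The objects of the category `Hilb_G(G)`: unitary equivariant vector bundles over `G`. -/
structure HilbG (G : Type w) [Group G] where
  data : BundleData.{u} G
  isUnitary : data.IsUnitaryBundle

/-- Morphisms of equivariant vector bundles over `G`: families of linear maps on the fibres which
commute with the action of `G`. -/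
@[ext]
structure HilbGHom {G : Type w} [Group G] (E E' : HilbG.{u} G) where
  app : ∀ x : G, E.data.fiber x →ₗ[ℂ] E'.data.fiber x
  equivariant : ∀ (g x y : G) (h : y = g * x * g⁻¹),
    E'.data.act g h ∘ₗ app x = app y ∘ₗ E.data.act g h

/-- The category `Hilb_G(G)`. -/
@[simps]
instance HilbG.category (G : Type w) [Group G] : Category (HilbG.{u} G) where
  Hom E E' := HilbGHom E E'
  id E := ⟨fun x => LinearMap.id, fun g x y h => rfl⟩
  comp f f' := ⟨fun x => f'.app x ∘ₗ f.app x, fun g x y h => by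
    rw [← LinearMap.comp_assoc, f'.equivariant, LinearMap.comp_assoc, f.equivariant,
      LinearMap.comp_assoc]⟩

/-! ### The 2-character -/

section TwoCharacter

variable {G : Type w} [Group G]

/-- The transport `χ_α(g x g⁻¹ ← x)`, for `g x g⁻¹ = y`: it sends `θ : id ⇒ α_x` to the composite
`id ⇒ α_e ⇒ α_g α_{g⁻¹} ⇒ α_g α_x α_{g⁻¹} ⇒ α_{gx} α_{g⁻¹} ⇒ α_{g x g⁻¹}` built from `φ(e)`,
`φ(g, g⁻¹)⁻¹`, `θ`, `φ(g, x)` and `φ(g x, g⁻¹)`. -/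
def twoCharTransport (α : TwoRep.{v, u} G) (g : G) {x y : G} (h : y = g * x * g⁻¹)
    (θ : 𝟭 α.space ⟶ (α.act x).functor) : 𝟭 α.space ⟶ (α.act y).functor :=
  α.unitIso.hom ≫ eqToHom (by rw [mul_inv_cancel]) ≫ (α.mulIso g g⁻¹).inv ≫
    Functor.whiskerLeft (α.act g⁻¹).functor (Functor.whiskerRight θ (α.act g).functor) ≫
      Functor.whiskerLeft (α.act g⁻¹).functor (α.mulIso g x).hom ≫
        (α.mulIso (g * x) g⁻¹).hom ≫ eqToHom (by rw [h])

/-- The 2-character `χ_α` of a unitary 2-representation: its fibre at `x` is the 2-trace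
`Nat(id, α_x)`. -/
noncomputable def twoChar (α : TwoRep.{v, u} G) : BundleData.{max u v} G where
  fiber x := 𝟭 α.space ⟶ (α.act x).functor
  form x θ θ' := natInner θ θ'
  act g x y h :=
    { toFun := twoCharTransport α g h
      map_add' := fun θ θ' => by
        ext X
        simp [twoCharTransport, Functor.map_add]
      map_smul' := fun c θ => by
        ext X
        simp [twoCharTransport, Functor.map_smul] }

/-- The map `χ(σ)_x : χ_α(x) → χ_β(x)` computed with an ambidextrous adjoint `σ*` of `σ`: it sends
`θ : id ⇒ α_x` to the composite `id ⇒ σ σ* ⇒ σ α_x σ* ⇒ β_x σ σ* ⇒ β_x` built from the unit of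
`σ* ⊣ σ`, `θ`, the inverse of `σ(x)`, and the counit of `σ ⊣ σ*`. -/
def twoCharMap {α β : TwoRep.{v, u} G} (σ : TwoRepHom α β) (A : AmbiAdjoint σ.base) (x : G) :
    (𝟭 α.space ⟶ (α.act x).functor) →ₗ[ℂ] (𝟭 β.space ⟶ (β.act x).functor) where
  toFun θ := A.asLeft.unit ≫
    Functor.whiskerLeft A.adjoint.functor (Functor.whiskerRight θ σ.base.functor) ≫
      Functor.whiskerLeft A.adjoint.functor (σ.iso x).inv ≫
        Functor.whiskerRight A.asRight.counit (β.act x).functor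
  map_add' θ θ' := by
    ext X
    simp [Functor.map_add]
  map_smul' c θ := by
    ext X
    simp [Functor.map_smul]

end TwoCharacter

/-! All four claims reduce to one construction. A 1-morphism F with an ambidextrous adjoint,
together with an intertwiner κ from QF to PF-type composites (Q after F against F after P), sends
Nat(id, P) to Nat(id, Q): this is `endCharMap`. Its central property, `endCharMap_congr`, is
invariance under natural isomorphisms F ≅ F' compatible with the intertwiners, for arbitrary
even-handed adjoints on both sides. The isomorphism induces a comparison t between the adjoints
through F ⊣ F*. Even-handedness expresses each left adjunction as the Hilbert space adjoint of the
right one, so the same t also compares the units of F* ⊣ F, and naturality cancels it.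

Taking the identity isomorphism gives independence of the adjoint, and an invertible 2-morphism
gives (iii). Composites of even-handed adjoints are even-handed, whence (iv) by `endCharMap_comp`
and `endCharMap_id`. For (ii), the transport of χ_α along g is itself such a map, that of α_g with
adjoint α_{g⁻¹} (`twoCharTransport_eq`). Equivariance then compares β_g σ with σ α_g through σ(g),
and functoriality of the transport uses φ(e) and φ(g₂, g₁) in the same way.

Two further ingredients come from semisimplicity. Positivity of the inner products splits
monomorphisms, and with Schur's lemma yields the resolution of the identity `sum_dag_onb_comp_onb`.
Hence hom(F -, y) can be represented by choosing isometries on simple objects only. This produces a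
unitary adjunction φ, and ψ = * φ⁻¹ * makes it even-handed. Finally the transport is unitary because
α_{g⁻¹} permutes the classes of simple objects, while the summands k_i (θ, θ') do not depend on the
representatives. -/

open Limits Module

/-! ### Inner products and the involution on hom-spaces -/

/-- A finite-dimensional space with a positive definite form has an orthonormal basis. -/
theorem InnerProductSpace.Core.exists_orthonormal_basis {V : Type*} [AddCommGroup V] [Module ℂ V]
    [FiniteDimensional ℂ V] (c : InnerProductSpace.Core ℂ V) :
    ∃ b : Basis (Fin (finrank ℂ V)) ℂ V, ∀ i j, c.inner (b i) (b j) = if i = j then 1 else 0 := by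
  let _ : NormedAddCommGroup V := c.toNormedAddCommGroup
  let _ : InnerProductSpace ℂ V := InnerProductSpace.ofCore c.toCore
  let b := stdOrthonormalBasis ℂ V
  refine ⟨b.toBasis, fun i j => ?_⟩
  have := (orthonormal_iff_ite.mp b.orthonormal) i j
  simpa using this

namespace TwoHilb

section Hom

variable {H : TwoHilb.{v, u}}

instance (x y : H) : FiniteDimensional ℂ (x ⟶ y) := TwoHilbertSpace.homFinite x y

@[simp] theorem dag_dag {x y : H} (f : x ⟶ y) : dag (dag f) = f :=
  TwoHilbertSpace.dagger_dagger f

theorem dag_comp {x y z : H} (f : x ⟶ y) (g : y ⟶ z) : dag (f ≫ g) = dag g ≫ dag f :=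
  TwoHilbertSpace.dagger_comp f g

@[simp] theorem dag_id (x : H) : dag (𝟙 x) = 𝟙 x := by
  simpa using (IsUnitary.id x).1

theorem dag_smul {x y : H} (c : ℂ) (f : x ⟶ y) :
    dag (c • f) = (starRingEnd ℂ) c • dag f :=
  TwoHilbertSpace.dagger_smul c f

@[simp] theorem dag_zero {x y : H} : dag (0 : x ⟶ y) = 0 := by
  have := dag_smul (0 : ℂ) (0 : x ⟶ y)
  simpa using this

theorem dag_injective {x y : H} : Function.Injective (dag : (x ⟶ y) → (y ⟶ x)) :=
  fun f g h => by rw [← dag_dag f, h, dag_dag]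

theorem inn_comp_left {x y z : H} (g : x ⟶ y) (f : y ⟶ z) (h : x ⟶ z) :
    inn (g ≫ f) h = inn g (h ≫ dag f) := TwoHilbertSpace.inner_comp_left g f h

theorem inn_comp_right {x y z : H} (g : x ⟶ y) (f : y ⟶ z) (h : x ⟶ z) :
    inn (g ≫ f) h = inn f (dag g ≫ h) := TwoHilbertSpace.inner_comp_right g f h

theorem inn_conj_symm {x y : H} (f g : x ⟶ y) : (starRingEnd ℂ) (inn g f) = inn f g :=
  (TwoHilbertSpace.homInner x y).conj_inner_symm f g

theorem inn_add_left {x y : H} (f g h : x ⟶ y) : inn (f + g) h = inn f h + inn g h :=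
  (TwoHilbertSpace.homInner x y).add_left f g h

theorem inn_smul_left {x y : H} (c : ℂ) (f g : x ⟶ y) :
    inn (c • f) g = (starRingEnd ℂ) c * inn f g :=
  (TwoHilbertSpace.homInner x y).smul_left f g c

theorem inn_add_right {x y : H} (f g h : x ⟶ y) : inn f (g + h) = inn f g + inn f h := by
  rw [← inn_conj_symm, inn_add_left, map_add, inn_conj_symm, inn_conj_symm]

theorem inn_smul_right {x y : H} (c : ℂ) (f g : x ⟶ y) : inn f (c • g) = c * inn f g := by
  rw [← inn_conj_symm, inn_smul_left, map_mul, inn_conj_symm, Complex.conj_conj]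

theorem inn_self_eq_zero {x y : H} {f : x ⟶ y} (h : inn f f = 0) : f = 0 :=
  (TwoHilbertSpace.homInner x y).definite f h

theorem inn_self_re_nonneg {x y : H} (f : x ⟶ y) : 0 ≤ (inn f f).re :=
  (TwoHilbertSpace.homInner x y).re_inner_nonneg f

theorem inn_self_ofReal {x y : H} (f : x ⟶ y) : ((inn f f).re : ℂ) = inn f f :=
  Complex.conj_eq_iff_re.mp (inn_conj_symm f f)

@[simp] theorem inn_zero_left {x y : H} (f : x ⟶ y) : inn 0 f = 0 := by
  simpa using inn_smul_left (0 : ℂ) (0 : x ⟶ y) f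

theorem inn_sum_left {x y : H} {ι : Type*} (s : Finset ι) (f : ι → (x ⟶ y)) (g : x ⟶ y) :
    inn (∑ i ∈ s, f i) g = ∑ i ∈ s, inn (f i) g :=
  map_sum (AddMonoidHom.mk' (fun f : x ⟶ y => inn f g) fun a b => inn_add_left a b g) f s

/-- The inner product, linear in the second variable. -/
noncomputable def innₗ {x y : H} (f : x ⟶ y) : (x ⟶ y) →ₗ[ℂ] ℂ where
  toFun := inn f
  map_add' := inn_add_right f
  map_smul' c g := by simp [inn_smul_right]

theorem inn_sum_right {x y : H} {ι : Type*} (s : Finset ι) (f : x ⟶ y) (g : ι → (x ⟶ y)) :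
    inn f (∑ i ∈ s, g i) = ∑ i ∈ s, inn f (g i) :=
  map_sum (innₗ f) g s

theorem ext_inn {x y : H} {f g : x ⟶ y} (h : ∀ k, inn k f = inn k g) : f = g := by
  have h1 : inn (f + (-1 : ℂ) • g) (f + (-1 : ℂ) • g) = 0 := by
    rw [inn_add_right, inn_smul_right, h]
    ring
  have h2 := inn_self_eq_zero h1
  rw [neg_one_smul] at h2
  exact eq_of_sub_eq_zero (by rw [sub_eq_add_neg, h2])

/-- Since (f, f) = (id, `f ≫ f†`), this is positive definiteness. The cancellation arguments below
use positivity in this form. -/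
theorem eq_zero_of_comp_dag {x y : H} {f : x ⟶ y} (h : f ≫ dag f = 0) : f = 0 := by
  apply inn_self_eq_zero
  have := inn_comp_left (𝟙 x) f f
  rw [Category.id_comp, h] at this
  rw [this, ← inn_conj_symm]
  simp

theorem inn_comp_isUnitary_right {x y z : H} (f g : x ⟶ y) {w : y ⟶ z} (hw : IsUnitary w) :
    inn (f ≫ w) (g ≫ w) = inn f g := by
  rw [inn_comp_left, Category.assoc, hw.1, Category.comp_id]

theorem inn_comp_isUnitary_left {x y z : H} {w : x ⟶ y} (hw : IsUnitary w) (f g : y ⟶ z) :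
    inn (w ≫ f) (w ≫ g) = inn f g := by
  rw [inn_comp_right, ← Category.assoc, hw.2, Category.id_comp]

theorem IsUnitary.dag {x y : H} {f : x ⟶ y} (h : IsUnitary f) : IsUnitary (dag f) := by
  simpa [IsUnitary] using h.symm

theorem IsUnitary.dag_eq_inv {x y : H} {f : x ⟶ y} (h : IsUnitary f) {g : y ⟶ x}
    (hg : f ≫ g = 𝟙 x) : TwoHilb.dag f = g := by
  rw [← Category.comp_id (TwoHilb.dag f), ← hg, ← Category.assoc, h.2, Category.id_comp]

end Hom

/-! ### Semisimplicity -/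

section Semisimple

variable {H : TwoHilb.{v, u}}

/-- Composing with `f ≫ f†` is injective on End(x) by positivity, hence surjective by finite
dimension. A preimage h of the identity gives, after applying the involution, the retraction `f† ≫
h†`. -/
theorem exists_retraction {x y : H} (f : x ⟶ y) [Mono f] : ∃ r : y ⟶ x, f ≫ r = 𝟙 x := by
  let L : (x ⟶ x) →ₗ[ℂ] (x ⟶ x) := Linear.rightComp ℂ x (f ≫ dag f)
  have hL : Function.Injective L := by
    refine (injective_iff_map_eq_zero L).mpr fun g hg => ?_
    have hg' : g ≫ f ≫ dag f = 0 := hg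
    have h0 : g ≫ f = 0 := by
      apply eq_zero_of_comp_dag
      rw [dag_comp, Category.assoc, ← Category.assoc f, ← Category.assoc g, hg', zero_comp]
    exact zero_of_comp_mono f h0
  obtain ⟨h, hh⟩ := LinearMap.injective_iff_surjective.mp hL (𝟙 x)
  have hh' : h ≫ f ≫ dag f = 𝟙 x := hh
  refine ⟨dag f ≫ dag h, ?_⟩
  have := congrArg dag hh'
  simpa [dag_comp] using this

/-- A retraction r of f embeds End(x) into End(y) by sending g to `r ≫ g ≫ f`. If the dimensions
agreed, the identity of y would have this form and f would be split epi. The dimension of End thus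
measures size for the descent to a simple subobject. -/
theorem finrank_end_lt {x y : H} (f : x ⟶ y) [Mono f] (hf : ¬ IsIso f) :
    finrank ℂ (x ⟶ x) < finrank ℂ (y ⟶ y) := by
  obtain ⟨r, hr⟩ := exists_retraction f
  let L : (x ⟶ x) →ₗ[ℂ] (y ⟶ y) := Linear.leftComp ℂ y r ∘ₗ Linear.rightComp ℂ x f
  have hL : Function.Injective L := by
    intro g g' h
    have h' : r ≫ g ≫ f = r ≫ g' ≫ f := h
    have := congrArg (fun t => f ≫ t ≫ r) h'
    simpa [reassoc_of% hr, hr] using this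
  refine lt_of_le_of_ne (LinearMap.finrank_le_finrank_of_injective hL) fun heq => hf ?_
  obtain ⟨g, hg⟩ := (LinearMap.injective_iff_surjective_of_finrank_eq_finrank heq).mp hL (𝟙 y)
  have hg' : r ≫ g ≫ f = 𝟙 y := hg
  have : IsSplitEpi f := ⟨⟨⟨r ≫ g, by simpa using hg'⟩⟩⟩
  exact isIso_of_mono_of_isSplitEpi f

theorem exists_simple_mono (x : H) (hx : ¬ IsZero x) :
    ∃ (s : H) (_ : Simple s) (i : s ⟶ x), Mono i := by
  induction hn : finrank ℂ (x ⟶ x) using Nat.strong_induction_on generalizing x with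
  | _ n ih =>
    by_cases hs : Simple x
    · exact ⟨x, hs, 𝟙 x, inferInstance⟩
    · have : ∃ (y : H) (f : y ⟶ x), Mono f ∧ f ≠ 0 ∧ ¬ IsIso f := by
        by_contra hcon
        push Not at hcon
        refine hs ⟨fun {y} f _ => ⟨fun hi h0 => hx ?_, fun h0 => hcon y f inferInstance h0⟩⟩
        subst h0
        exact (IsZero.iff_id_eq_zero x).mpr (by rw [← IsIso.inv_hom_id (0 : y ⟶ x), comp_zero])
      obtain ⟨y, f, hm, h0, hi⟩ := this
      obtain ⟨s, hs, i, hi'⟩ := ih _ (hn ▸ finrank_end_lt f hi) y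
        (fun hz => h0 (hz.eq_of_src _ _)) rfl
      exact ⟨s, hs, i ≫ f, mono_comp _ _⟩

instance (i : SimpleClass H) : Simple (simpleRep i) := (Quotient.out i : SimpleObj H).2

/-- The isomorphism class of a simple object. -/
def simpleClass (s : H) [hs : Simple s] : SimpleClass H := Quotient.mk _ (⟨s, hs⟩ : SimpleObj H)

theorem nonempty_iso_simpleRep (s : H) [hs : Simple s] :
    Nonempty (simpleRep (simpleClass s) ≅ s) :=
  @Quotient.mk_out _ (simpleSetoid H) ⟨s, hs⟩

theorem eq_of_simpleRep_iso {i j : SimpleClass H} (h : simpleRep i ≅ simpleRep j) : i = j := by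
  rw [← Quotient.out_eq i, ← Quotient.out_eq j]
  exact Quotient.sound ⟨h⟩

/-- If f is nonzero, its image contains a simple subobject, included in z by k. The hypothesis
concerns maps into x, so k is pulled back to `k ≫ f†`. Two applications of positivity then force k =
0, contradicting that k is a monomorphism from a simple object. -/
theorem eq_zero_of_simpleRep_comp {x z : H} {f : x ⟶ z}
    (h : ∀ i (b : simpleRep i ⟶ x), b ≫ f = 0) : f = 0 := by
  by_contra hf
  have hI : ¬ IsZero (image f) := fun hz => hf (by
    rw [← image.fac f, hz.eq_of_tgt (factorThruImage f) 0, zero_comp])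
  obtain ⟨s, hs, m, hm⟩ := exists_simple_mono _ hI
  obtain ⟨e⟩ := nonempty_iso_simpleRep s
  set k := m ≫ image.ι f with hk
  have h1 : k ≫ dag f ≫ f = 0 := by
    have := h _ (e.hom ≫ k ≫ dag f)
    rw [Category.assoc, Category.assoc] at this
    exact (cancel_epi e.hom).mp (by rw [this, comp_zero])
  have h2 : k ≫ dag f = 0 := by
    apply eq_zero_of_comp_dag
    rw [dag_comp, dag_dag, Category.assoc, ← Category.assoc (dag f), ← Category.assoc k, h1,
      zero_comp]
  have h3 : f ≫ dag k = 0 := by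
    have := congrArg dag h2
    simpa [dag_comp] using this
  have h4 : image.ι f ≫ dag k = 0 := by
    rw [← image.fac f, Category.assoc] at h3
    exact (cancel_epi (factorThruImage f)).mp (by rw [h3, comp_zero])
  have h5 : k = 0 := by
    apply eq_zero_of_comp_dag
    nth_rewrite 1 [hk]
    rw [Category.assoc, h4, comp_zero]
  have : Mono k := mono_comp _ _
  exact id_nonzero s (zero_of_comp_mono k (by rw [h5, comp_zero]))

/-- The scale factors do not vanish. -/
theorem scale_ne_zero (i : SimpleClass H) : scale i ≠ 0 :=
  fun h => id_nonzero (simpleRep i) (inn_self_eq_zero h)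

theorem scale_ofReal (i : SimpleClass H) : ((scale i).re : ℂ) = scale i := inn_self_ofReal _

theorem scale_conj (i : SimpleClass H) : (starRingEnd ℂ) (scale i) = scale i := inn_conj_symm _ _

theorem scale_re_pos (i : SimpleClass H) : 0 < (scale i).re :=
  lt_of_le_of_ne (inn_self_re_nonneg _) fun h => scale_ne_zero i (by
    rw [← scale_ofReal, ← h, Complex.ofReal_zero])

theorem simpleRep_hom_eq_zero {i j : SimpleClass H} (h : i ≠ j) (f : simpleRep i ⟶ simpleRep j) :
    f = 0 := by
  by_contra hf
  have := isIso_of_hom_simple hf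
  exact h (eq_of_simpleRep_iso (asIso f))

/-- An orthonormal basis of `hom(e_i, x)`. -/
noncomputable def onb (x : H) (i : SimpleClass H) :
    Basis (Fin (finrank ℂ (simpleRep i ⟶ x))) ℂ (simpleRep i ⟶ x) :=
  ((TwoHilbertSpace.homInner (simpleRep i) x).exists_orthonormal_basis).choose

theorem inn_onb (x : H) (i : SimpleClass H) (k l) :
    inn (onb x i k) (onb x i l) = if k = l then 1 else 0 :=
  ((TwoHilbertSpace.homInner (simpleRep i) x).exists_orthonormal_basis).choose_spec k l

theorem onb_repr (x : H) (i : SimpleClass H) (b : simpleRep i ⟶ x) :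
    b = ∑ k, inn (onb x i k) b • onb x i k := by
  conv_lhs => rw [← (onb x i).sum_repr b]
  refine Finset.sum_congr rfl fun k _ => ?_
  congr 1
  have := congrArg (inn (onb x i k)) ((onb x i).sum_repr b)
  rw [inn_sum_right] at this
  simpa [inn_smul_right, inn_onb] using this

/-- By Schur's lemma `b ≫ a†` is a scalar c; pairing with the identity gives (a, b) = c k_i. -/
theorem scale_smul_comp_dag {x : H} {i : SimpleClass H} (a b : simpleRep i ⟶ x) :
    scale i • (b ≫ dag a) = inn a b • 𝟙 (simpleRep i) := by
  obtain ⟨c, hc⟩ := endomorphism_simple_eq_smul_id ℂ (b ≫ dag a)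
  have h : inn a b = c * scale i := by
    have := inn_comp_left (𝟙 _) a b
    rw [Category.id_comp, ← hc, inn_smul_right] at this
    exact this
  rw [← hc, h, smul_smul, mul_comm]

/-- An expression which is bilinear in `e_j → e_i` and `e_i → x` can be evaluated by inserting the
orthonormal bases of the spaces `hom(e_i, x)`. -/
theorem sum_scale_comp_onb {x : H} {W : Type*} [AddCommGroup W] [Module ℂ W] {j : SimpleClass H}
    (b : simpleRep j ⟶ x) (L : ∀ i, (simpleRep j ⟶ simpleRep i) →ₗ[ℂ] (simpleRep i ⟶ x) →ₗ[ℂ] W) :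
    ∑ i, ∑ k, scale i • L i (b ≫ dag (onb x i k)) (onb x i k) = L j (𝟙 _) b := by
  -- Schur's lemma kills every i ≠ j. For i = j it replaces the weighted composite by the
  -- coefficient of b along the basis vector, and the sum over k reassembles b.
  rw [Finset.sum_eq_single j]
  · conv_rhs => rw [onb_repr x j b]
    rw [map_sum]
    refine Finset.sum_congr rfl fun k _ => ?_
    rw [← LinearMap.smul_apply, ← map_smul, scale_smul_comp_dag, map_smul, map_smul,
      LinearMap.smul_apply]
  · intro i _ hij
    refine Finset.sum_eq_zero fun k _ => ?_
    rw [simpleRep_hom_eq_zero hij.symm (b ≫ dag (onb x i k))]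
    simp
  · simp

/-- This resolution of the identity can be tested on maps from simple objects, where it is the basis
expansion. The weight k_i appears because an orthonormal basis vector b satisfies `b ≫ b†` = k_i⁻¹
id. -/
theorem sum_dag_onb_comp_onb (x : H) :
    ∑ i, ∑ k, scale i • (dag (onb x i k) ≫ onb x i k) = 𝟙 x := by
  rw [← sub_eq_zero]
  refine eq_zero_of_simpleRep_comp fun j b => ?_
  rw [Preadditive.comp_sub, sub_eq_zero, Category.comp_id]
  have := sum_scale_comp_onb b fun i => Linear.comp (S := ℂ) (simpleRep j) (simpleRep i) x
  simp only [Linear.comp_apply, Linear.leftComp_apply, Category.id_comp, Category.assoc] at this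
  refine Eq.trans ?_ this
  simp only [Preadditive.comp_sum, Linear.comp_smul]

end Semisimple

end TwoHilb

/-! ### Existence of even-handed ambidextrous adjoints -/

/-- Spaces of equal finite dimension with positive definite forms are isometric. -/
theorem InnerProductSpace.Core.exists_isometry {V W : Type*} [AddCommGroup V] [Module ℂ V]
    [FiniteDimensional ℂ V] [AddCommGroup W] [Module ℂ W] [FiniteDimensional ℂ W]
    (c : InnerProductSpace.Core ℂ V) (d : InnerProductSpace.Core ℂ W)
    (h : finrank ℂ V = finrank ℂ W) :
    ∃ T : V ≃ₗ[ℂ] W, ∀ a b, d.inner (T a) (T b) = c.inner a b := by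
  let _ : NormedAddCommGroup V := c.toNormedAddCommGroup
  let _ : InnerProductSpace ℂ V := InnerProductSpace.ofCore c.toCore
  let _ : NormedAddCommGroup W := d.toNormedAddCommGroup
  let _ : InnerProductSpace ℂ W := InnerProductSpace.ofCore d.toCore
  let T : V ≃ₗᵢ[ℂ] W := (stdOrthonormalBasis ℂ V).equiv (stdOrthonormalBasis ℂ W) (finCongr h)
  exact ⟨T.toLinearEquiv, fun a b => T.inner_map_map a b⟩

namespace TwoHilb

variable {H H' : TwoHilb.{v, u}}

/-- There is an object with prescribed multiplicities of the simple objects. -/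
theorem exists_finrank_hom_eq (m : SimpleClass H → ℕ) :
    ∃ r : H, ∀ j, finrank ℂ (simpleRep j ⟶ r) = m j := by
  classical
  let f : (Σ i, Fin (m i)) → H := fun p => simpleRep p.1
  have := Abelian.hasFiniteBiproducts (C := H)
  refine ⟨⨁ f, fun j => ?_⟩
  let e : (simpleRep j ⟶ ⨁ f) ≃ₗ[ℂ] (∀ p, simpleRep j ⟶ f p) :=
    { toFun := fun g p => g ≫ biproduct.π f p
      invFun := fun g => biproduct.lift g
      left_inv := fun g => by ext; simp
      right_inv := fun g => by ext; simp
      map_add' := fun g g' => by ext; simp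
      map_smul' := fun c g => by ext; simp }
  have hf : ∀ p, finrank ℂ (simpleRep j ⟶ f p) = if p.1 = j then 1 else 0 := by
    intro p
    split_ifs with h
    · subst h
      exact finrank_endomorphism_simple_eq_one ℂ _
    · exact finrank_hom_simple_simple_eq_zero_of_not_iso ℂ
        fun i => h (eq_of_simpleRep_iso i).symm
  rw [e.finrank_eq, finrank_pi_fintype, Finset.sum_congr rfl fun p _ => hf p, Fintype.sum_sigma]
  simp [apply_ite]

/-- Morphisms out of `F x` are determined by their restrictions to the `F e_i`. -/
theorem map_comp_ext (F : LinStarFunctor H H') {x : H} {y : H'} {h h' : F.functor.obj x ⟶ y}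
    (hh : ∀ i (b : simpleRep i ⟶ x), F.functor.map b ≫ h = F.functor.map b ≫ h') : h = h' := by
  rw [← Category.id_comp h, ← Category.id_comp h', ← F.functor.map_id, ← sum_dag_onb_comp_onb x]
  simp only [Functor.map_sum, Functor.map_smul, Functor.map_comp, Preadditive.sum_comp,
    Linear.smul_comp, Category.assoc, hh]

/-- Any family of linear maps `hom(F e_i, y) → hom(F' e_i, r)` extends to maps
`hom(F x, y) → hom(F' x, r)` compatible with restriction along morphisms `e_i → x`. -/
theorem exists_hom_of_simpleRep {K K' : TwoHilb.{v, u}} (F : LinStarFunctor H K)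
    (F' : LinStarFunctor H K') {y : K} {r : K'}
    (V : ∀ i : SimpleClass H, (F.functor.obj (simpleRep i) ⟶ y) →ₗ[ℂ]
      (F'.functor.obj (simpleRep i) ⟶ r)) (x : H) (f : F.functor.obj x ⟶ y) :
    ∃ h : F'.functor.obj x ⟶ r, ∀ i (b : simpleRep i ⟶ x),
      F'.functor.map b ≫ h = V i (F.functor.map b ≫ f) := by
  refine ⟨∑ i, ∑ k, scale i • (F'.functor.map (dag (onb x i k)) ≫
    V i (F.functor.map (onb x i k) ≫ f)), fun j b => ?_⟩
  have := sum_scale_comp_onb b fun i =>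
    (((Linear.comp (S := ℂ) (F'.functor.obj (simpleRep j)) (F'.functor.obj (simpleRep i)) r) ∘ₗ
      F'.functor.mapLinearMap ℂ).compl₂
        ((V i ∘ₗ Linear.rightComp ℂ _ f) ∘ₗ F.functor.mapLinearMap ℂ))
  simp only [LinearMap.compl₂_apply, LinearMap.comp_apply, Functor.coe_mapLinearMap,
    Linear.comp_apply, Linear.leftComp_apply, Linear.rightComp_apply, Functor.map_comp,
    Category.assoc] at this
  rw [F'.functor.map_id, Category.id_comp] at this
  refine Eq.trans ?_ this
  simp only [Preadditive.comp_sum, Linear.comp_smul]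

/-- The inner product of morphisms out of `F x` in terms of their restrictions to the `F e_i`. -/
theorem inn_eq_sum_onb (F : LinStarFunctor H H') {x : H} {y : H'} (f f' : F.functor.obj x ⟶ y) :
    inn f f' = ∑ i, ∑ k, scale i *
      inn (F.functor.map (onb x i k) ≫ f) (F.functor.map (onb x i k) ≫ f') := by
  conv_lhs => rw [← Category.id_comp f, ← F.functor.map_id, ← sum_dag_onb_comp_onb x]
  simp only [Functor.map_sum, Functor.map_smul, Functor.map_comp, Preadditive.sum_comp,
    Linear.smul_comp, Category.assoc, inn_sum_left, inn_smul_left, scale_conj]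
  refine Finset.sum_congr rfl fun i _ => Finset.sum_congr rfl fun k _ => ?_
  rw [inn_comp_right, F.map_dag, dag_dag]

/-- The functor `hom(F -, y)` is unitarily represented by an object of `H`. -/
theorem exists_unitary_representation (F : LinStarFunctor H H') (y : H') :
    ∃ (r : H) (e : ∀ x : H, (F.functor.obj x ⟶ y) ≃ (x ⟶ r)),
      (∀ (x' x : H) (c : x' ⟶ x) (f : F.functor.obj x ⟶ y),
        e x' (F.functor.map c ≫ f) = c ≫ e x f) ∧
      ∀ (x : H) (f f' : F.functor.obj x ⟶ y), inn (e x f) (e x f') = inn f f' := by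
  obtain ⟨r, hr⟩ := exists_finrank_hom_eq
    fun i : SimpleClass H => finrank ℂ (F.functor.obj (simpleRep i) ⟶ y)
  -- The isometries are arbitrary: between simple representatives there are only scalars, so
  -- naturality imposes no condition on them.
  choose V hV using fun i : SimpleClass H =>
    (TwoHilbertSpace.homInner (F.functor.obj (simpleRep i)) y).exists_isometry
      (TwoHilbertSpace.homInner (simpleRep i) r) (hr i).symm
  choose φ hφ using exists_hom_of_simpleRep F (LinStarFunctor.id H) (r := r)
    fun i => (V i).toLinearMap
  choose φ' hφ' using exists_hom_of_simpleRep (LinStarFunctor.id H) F (r := y)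
    fun i => (V i).symm.toLinearMap
  replace hφ : ∀ x (f : F.functor.obj x ⟶ y) i (b : simpleRep i ⟶ x),
    b ≫ φ x f = V i (F.functor.map b ≫ f) := hφ
  replace hφ' : ∀ x (f : x ⟶ r) i (b : simpleRep i ⟶ x),
    F.functor.map b ≫ φ' x f = (V i).symm (b ≫ f) := hφ'
  have hid : ∀ x (h h' : x ⟶ r), (∀ i (b : simpleRep i ⟶ x), b ≫ h = b ≫ h') → h = h' :=
    fun x h h' hh => map_comp_ext (LinStarFunctor.id H) hh
  refine ⟨r, fun x => ⟨φ x, φ' x, fun f => ?_, fun f => ?_⟩, fun x' x c f => ?_, fun x f f' => ?_⟩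
  · exact map_comp_ext F fun i b => by rw [hφ', hφ, LinearEquiv.symm_apply_apply]
  · exact hid _ _ _ fun i b => (hφ x _ i b).trans (by
      rw [hφ', LinearEquiv.apply_symm_apply])
  · refine hid _ _ _ fun i b => ?_
    simp only [Equiv.coe_fn_mk]
    rw [hφ, ← Category.assoc b, hφ, Functor.map_comp, Category.assoc]
  -- Both inner products split over the same bases of hom(e_i, x) with the same weights, so isometry
  -- need only hold for each V_i.
  · refine (inn_eq_sum_onb (LinStarFunctor.id H) _ _).trans ?_
    rw [inn_eq_sum_onb F]
    refine Finset.sum_congr rfl fun i _ => Finset.sum_congr rfl fun k _ => ?_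
    refine Eq.trans ?_ (congrArg (scale i * ·) (hV i _ _))
    rw [← hφ, ← hφ]
    rfl

end TwoHilb

/-- A linear `*`-functor has a right adjoint with unitary adjunction isomorphisms. -/
theorem LinStarFunctor.exists_unitary_rightAdjoint {H H' : TwoHilb.{v, u}}
    (F : LinStarFunctor H H') :
    ∃ (R : LinStarFunctor H' H) (adj : F.functor ⊣ R.functor),
      ∀ (x : H) (y : H') (f f' : F.functor.obj x ⟶ y),
        inn (adj.homEquiv x y f) (adj.homEquiv x y f') = inn f f' := by
  choose r e he hu using exists_unitary_representation F
  let R := Adjunction.rightAdjointOfEquiv (F := F.functor) (fun x y => e y x)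
    (fun x' x y c f => he y x' x c f)
  let adj : F.functor ⊣ R := Adjunction.adjunctionOfEquivRight (F := F.functor) (fun x y => e y x)
    (fun x' x y c f => he y x' x c f)
  have hadj : ∀ x y (f f' : F.functor.obj x ⟶ y),
      inn (adj.homEquiv x y f) (adj.homEquiv x y f') = inn f f' := fun x y f f' => by
    simpa [adj, Adjunction.adjunctionOfEquivRight] using hu y x f f'
  have hRadd : R.Additive := adj.right_adjoint_additive
  have hsmul : ∀ (x : H) (y : H') (c : ℂ) (f : F.functor.obj x ⟶ y),
      adj.homEquiv x y (c • f) = c • adj.homEquiv x y f := fun x y c f => by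
    -- Scaling by c is precomposition with c · id, so naturality in x gives homogeneity.
    rw [← Category.id_comp (adj.homEquiv x y f), ← Linear.smul_comp,
      ← adj.homEquiv_naturality_left, F.functor.map_smul, F.functor.map_id, Linear.smul_comp,
      Category.id_comp]
  have hlin : R.Linear ℂ := ⟨fun {y y'} g c => by
    have h1 := adj.homEquiv_naturality_right ((adj.homEquiv _ _).symm (𝟙 _)) (c • g)
    have h2 := adj.homEquiv_naturality_right ((adj.homEquiv _ _).symm (𝟙 _)) g
    rw [Equiv.apply_symm_apply, Category.id_comp] at h1 h2
    rw [← h1, ← h2, Linear.comp_smul, hsmul]⟩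
  refine ⟨⟨R, hRadd, hlin, fun {y y'} g => ext_inn fun k => ?_⟩, adj, hadj⟩
  -- Write k = φ(k') and id = φ(j). Unitarity and naturality of φ in y show that R(g†) and R(g)†
  -- both pair with k to give (k', `j ≫ g†`).
  have h0 := inn_comp_left k (R.map g) (𝟙 (R.obj y'))
  rw [Category.id_comp] at h0
  rw [← h0]
  obtain ⟨k', rfl⟩ := (adj.homEquiv _ _).surjective k
  obtain ⟨j, hj⟩ := (adj.homEquiv _ _).surjective (𝟙 (R.obj y'))
  rw [← adj.homEquiv_naturality_right, ← hj, hadj, inn_comp_left, ← hadj,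
    adj.homEquiv_naturality_right, hj, Category.id_comp]

/-- For unitary φ the Hilbert space adjoint is φ⁻¹, so even-handedness prescribes ψ = * φ⁻¹ *. Its
naturality follows from that of φ because both functors commute with the involution. -/
theorem AmbiAdjoint.exists_isEvenHanded {H H' : TwoHilb.{v, u}} (F : LinStarFunctor H H') :
    ∃ A : AmbiAdjoint F, A.IsEvenHanded := by
  obtain ⟨R, adj, hadj⟩ := F.exists_unitary_rightAdjoint
  let adj' : R.functor ⊣ F.functor := Adjunction.mkOfHomEquiv
    { homEquiv := fun y x =>
        { toFun := fun g => dag ((adj.homEquiv x y).symm (dag g))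
          invFun := fun f => dag (adj.homEquiv x y (dag f))
          left_inv := fun g => by simp
          right_inv := fun f => by simp }
      homEquiv_naturality_left_symm := fun f g => by
        simp only [Equiv.coe_fn_symm_mk]
        rw [dag_comp, adj.homEquiv_naturality_right, dag_comp, R.map_dag, dag_dag]
      homEquiv_naturality_right := fun f g => by
        simp only [Equiv.coe_fn_mk]
        rw [dag_comp, adj.homEquiv_naturality_left_symm, dag_comp, F.map_dag, dag_dag] }
  refine ⟨⟨R, adj, adj'⟩, fun x y f g => ?_⟩
  have : adj'.homEquiv y x g = dag ((adj.homEquiv x y).symm (dag g)) := by simp [adj']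
  rw [this, dag_dag, ← hadj, Equiv.apply_symm_apply]

/-! ### Traces of 1-morphisms between endofunctors -/

section EndChar

variable {H H' H'' : TwoHilb.{v, u}}

/-- A 1-morphism `F : H → H'` with an ambidextrous adjoint which intertwines endofunctors `P` of `H`
and `Q` of `H'` induces a map `Nat(id, P) → Nat(id, Q)`. -/
def endCharMap {F : LinStarFunctor H H'} (A : AmbiAdjoint F) {P : H ⥤ H} {Q : H' ⥤ H'}
    (κ : F.functor ⋙ Q ≅ P ⋙ F.functor) (θ : 𝟭 H ⟶ P) : 𝟭 H' ⟶ Q :=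
  A.asLeft.unit ≫ Functor.whiskerLeft A.adjoint.functor (Functor.whiskerRight θ F.functor) ≫
    Functor.whiskerLeft A.adjoint.functor κ.inv ≫ Functor.whiskerRight A.asRight.counit Q

theorem endCharMap_app {F : LinStarFunctor H H'} (A : AmbiAdjoint F) {P : H ⥤ H} {Q : H' ⥤ H'}
    (κ : F.functor ⋙ Q ≅ P ⋙ F.functor) (θ : 𝟭 H ⟶ P) (y : H') :
    (endCharMap A κ θ).app y = A.asLeft.unit.app y ≫
      F.functor.map (θ.app (A.adjoint.functor.obj y)) ≫ κ.inv.app (A.adjoint.functor.obj y) ≫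
        Q.map (A.asRight.counit.app y) := rfl

/-- `endCharMap` is invariant under natural isomorphisms compatible with the intertwiners. -/
theorem endCharMap_congr {F F' : LinStarFunctor H H'} {A : AmbiAdjoint F} {A' : AmbiAdjoint F'}
    (hA : A.IsEvenHanded) (hA' : A'.IsEvenHanded) {P : H ⥤ H} {Q : H' ⥤ H'}
    (κ : F.functor ⋙ Q ≅ P ⋙ F.functor) (κ' : F'.functor ⋙ Q ≅ P ⋙ F'.functor)
    (τ : F.functor ≅ F'.functor)
    (hτ : ∀ x, κ.hom.app x ≫ τ.hom.app (P.obj x) = Q.map (τ.hom.app x) ≫ κ'.hom.app x)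
    (θ : 𝟭 H ⟶ P) : endCharMap A κ θ = endCharMap A' κ' θ := by
  ext y
  -- The comparison of the two right adjoints at y: the mate of τ⁻¹.
  let t : A.adjoint.functor.obj y ⟶ A'.adjoint.functor.obj y :=
    A'.asRight.homEquiv _ _ (τ.inv.app _ ≫ A.asRight.counit.app y)
  have ht : F'.functor.map t ≫ A'.asRight.counit.app y =
      τ.inv.app _ ≫ A.asRight.counit.app y :=
    (A'.asRight.homEquiv_counit _ _ _).symm.trans (Equiv.symm_apply_apply _ _)
  have hφ : ∀ (x : H) (f : F'.functor.obj x ⟶ y), A'.asRight.homEquiv x y f =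
      A.asRight.homEquiv x y (τ.hom.app x ≫ f) ≫ t := fun x f => by
    rw [Adjunction.homEquiv_apply_eq, A'.asRight.homEquiv_naturality_left_symm,
      Equiv.symm_apply_apply, ← Category.assoc, τ.inv.naturality, Category.assoc,
      ← A.asRight.homEquiv_counit, Equiv.symm_apply_apply, Iso.inv_hom_id_app_assoc]
  -- Even-handedness enters here: taking Hilbert space adjoints in the relation between the two φ's
  -- shows that the same t relates the two ψ's. Without it the left and right comparisons could
  -- differ.
  have hψ : ∀ (x : H) (g : A'.adjoint.functor.obj y ⟶ x), A'.asLeft.homEquiv y x g =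
      A.asLeft.homEquiv y x (t ≫ g) ≫ τ.hom.app x := fun x g => dag_injective (ext_inn fun f => by
    rw [← hA', hφ, inn_comp_left, ← dag_comp, hA, inn_comp_right, ← dag_comp])
  have hn : A'.asLeft.unit.app y =
      A.asLeft.unit.app y ≫ F.functor.map t ≫ τ.hom.app (A'.adjoint.functor.obj y) := by
    rw [← A'.asLeft.homEquiv_id, hψ, Category.comp_id, A.asLeft.homEquiv_unit, Category.assoc]
  have hε : F.functor.map t ≫ τ.hom.app _ ≫ A'.asRight.counit.app y = A.asRight.counit.app y := by
    rw [← Category.assoc, τ.hom.naturality, Category.assoc, ht, Iso.hom_inv_id_app_assoc]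
  have hκ : ∀ x, τ.hom.app (P.obj x) ≫ κ'.inv.app x = κ.inv.app x ≫ Q.map (τ.hom.app x) :=
    fun x => by
      rw [← cancel_mono (κ'.hom.app x), ← cancel_epi (κ.hom.app x)]
      simp [hτ]
  -- One side now carries t next to the unit, the other next to the counit. Naturality of θ, κ⁻¹ and
  -- τ moves t across.
  rw [endCharMap_app, endCharMap_app, hn, ← hε]
  have h1 := τ.hom.naturality (θ.app (A'.adjoint.functor.obj y))
  have h2 := congrArg F.functor.map (θ.naturality t)
  have h3 := κ.inv.naturality t
  simp only [Functor.id_obj, Functor.id_map, Functor.comp_obj, Functor.comp_map,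
    Functor.map_comp, Category.assoc] at h1 h2 h3 ⊢
  rw [← reassoc_of% h1, reassoc_of% (hκ _), reassoc_of% h2, reassoc_of% h3]

/-- The composite of ambidextrous adjoints. -/
@[reducible]
def AmbiAdjoint.comp {F : LinStarFunctor H H'} {F' : LinStarFunctor H' H''} (A : AmbiAdjoint F)
    (A' : AmbiAdjoint F') : AmbiAdjoint (F.comp F') where
  adjoint := A'.adjoint.comp A.adjoint
  asRight := A.asRight.comp A'.asRight
  asLeft := A'.asLeft.comp A.asLeft

theorem AmbiAdjoint.IsEvenHanded.comp {F : LinStarFunctor H H'} {F' : LinStarFunctor H' H''}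
    {A : AmbiAdjoint F} {A' : AmbiAdjoint F'} (hA : A.IsEvenHanded) (hA' : A'.IsEvenHanded) :
    (A.comp A').IsEvenHanded := fun x y f g => by
  have h1 := hA x _ (A'.asRight.homEquiv _ y f) g
  have h2 := hA' _ y f (A.asLeft.homEquiv _ x g)
  simp only [Adjunction.comp_homEquiv]
  exact h1.trans h2

/-- The identity as an ambidextrous adjoint of the identity. -/
@[reducible]
def AmbiAdjoint.id (H : TwoHilb.{v, u}) : AmbiAdjoint (LinStarFunctor.id H) where
  adjoint := LinStarFunctor.id H
  asRight := Adjunction.id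
  asLeft := Adjunction.id

theorem AmbiAdjoint.isEvenHanded_id (H : TwoHilb.{v, u}) : (AmbiAdjoint.id H).IsEvenHanded :=
  fun x y f g => by
    have h (a b : H) (k : a ⟶ b) : (Adjunction.id (C := H)).homEquiv a b k = k :=
      (Adjunction.id.homEquiv_unit a b k).trans (Category.id_comp k)
    exact (congrArg (inn · (dag g)) (h x y f)).trans
      (congrArg (fun k => inn f (dag k)) (h y x g)).symm

/-- By invariance C may be replaced by the composite adjoint. Its unit and counit are nested, and
sliding the inner counit past κ'⁻¹ by naturality separates the two maps. -/
theorem endCharMap_comp {F : LinStarFunctor H H'} {F' : LinStarFunctor H' H''}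
    {A : AmbiAdjoint F} {A' : AmbiAdjoint F'} {C : AmbiAdjoint (F.comp F')} (hA : A.IsEvenHanded)
    (hA' : A'.IsEvenHanded) (hC : C.IsEvenHanded) {P : H ⥤ H} {Q : H' ⥤ H'} {R : H'' ⥤ H''}
    (κ : F.functor ⋙ Q ≅ P ⋙ F.functor) (κ' : F'.functor ⋙ R ≅ Q ⋙ F'.functor)
    (κ'' : (F.comp F').functor ⋙ R ≅ P ⋙ (F.comp F').functor)
    (hκ : ∀ x, κ''.hom.app x =
      κ'.hom.app (F.functor.obj x) ≫ F'.functor.map (κ.hom.app x)) (θ : 𝟭 H ⟶ P) :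
    endCharMap C κ'' θ = endCharMap A' κ' (endCharMap A κ θ) := by
  rw [endCharMap_congr hC (hA.comp hA') κ'' κ'' (Iso.refl _) (fun x => by simp)]
  ext z
  have hinv : ∀ x, κ''.inv.app x =
      F'.functor.map (κ.inv.app x) ≫ κ'.inv.app (F.functor.obj x) := fun x => by
    rw [← cancel_epi (κ''.hom.app x), Iso.hom_inv_id_app, hκ, Category.assoc,
      ← Category.assoc (F'.functor.map _), ← Functor.map_comp, Iso.hom_inv_id_app]
    simp
  have h1 := κ'.inv.naturality (A.asRight.counit.app (A'.adjoint.functor.obj z))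
  simp only [endCharMap_app, hinv]
  simp only [Functor.id_obj, Functor.comp_obj, Functor.comp_map, Functor.map_comp,
    Category.assoc, Adjunction.comp_unit_app, Adjunction.comp_counit_app] at h1 ⊢
  rw [reassoc_of% h1]

theorem endCharMap_id {A : AmbiAdjoint (LinStarFunctor.id H)} (hA : A.IsEvenHanded) {P : H ⥤ H}
    (κ : (LinStarFunctor.id H).functor ⋙ P ≅ P ⋙ (LinStarFunctor.id H).functor)
    (hκ : ∀ x, κ.hom.app x = 𝟙 (P.obj x)) (θ : 𝟭 H ⟶ P) : endCharMap A κ θ = θ := by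
  rw [endCharMap_congr hA (AmbiAdjoint.isEvenHanded_id H) κ κ (Iso.refl _) (fun x => by simp)]
  ext x
  have hinv : κ.inv.app x = 𝟙 (P.obj x) := by
    rw [← cancel_epi (κ.hom.app x), Iso.hom_inv_id_app, hκ]
    exact (Category.comp_id _).symm
  rw [endCharMap_app]
  simp [Adjunction.id, hinv]

end EndChar

/-! ### The transport of the 2-character as a trace -/

namespace TwoRep

variable {G : Type w} [Group G] (α : TwoRep.{v, u} G)

instance (g : G) : (α.act g).functor.Full := ⟨fun {x y} => α.act_surjective g x y⟩

instance (g : G) : (α.act g).functor.Faithful := ⟨fun {x y} f f' h => ext_inn fun k => by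
  rw [← α.act_inner g, h, α.act_inner]⟩

/-- The isomorphism `φ(g₂, g₁) : α_{g₂} ∘ α_{g₁} ⇒ α_k` for `k = g₂ g₁`. -/
def mulIsoOf {g₂ g₁ k : G} (h : k = g₂ * g₁) :
    (α.act g₁).functor ⋙ (α.act g₂).functor ≅ (α.act k).functor :=
  α.mulIso g₂ g₁ ≪≫ eqToIso (by rw [h])

theorem mulIsoOf_self (g₂ g₁ : G) : α.mulIsoOf (rfl : g₂ * g₁ = g₂ * g₁) = α.mulIso g₂ g₁ := by
  simp [mulIsoOf]

theorem mulIsoOf_unitary {g₂ g₁ k : G} (h : k = g₂ * g₁) (x : α.space) :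
    IsUnitary ((α.mulIsoOf h).hom.app x) := by
  subst h
  rw [mulIsoOf_self]
  exact α.mul_unitary g₂ g₁ x

theorem unit_mulIsoOf (g : G) (x : α.space) :
    α.unitIso.hom.app ((α.act g).functor.obj x) ≫ (α.mulIsoOf (one_mul g).symm).hom.app x =
      𝟙 _ := by
  have := α.unit_mul g x
  simp [mulIsoOf, eqToHom_app, reassoc_of% this]

theorem mulIsoOf_unit (g : G) (x : α.space) :
    (α.act g).functor.map (α.unitIso.hom.app x) ≫ (α.mulIsoOf (mul_one g).symm).hom.app x =
      𝟙 _ := by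
  have := α.mul_unit g x
  simp [mulIsoOf, eqToHom_app, reassoc_of% this]

/-- Leaving the products as free indices absorbs the transport along associativity in G. -/
theorem mulIsoOf_assoc {g₃ g₂ g₁ a b k : G} (ha : a = g₃ * g₂) (hb : b = g₂ * g₁)
    (hk : k = a * g₁) (hk' : k = g₃ * b) (x : α.space) :
    (α.mulIsoOf ha).hom.app ((α.act g₁).functor.obj x) ≫ (α.mulIsoOf hk).hom.app x =
      (α.act g₃).functor.map ((α.mulIsoOf hb).hom.app x) ≫ (α.mulIsoOf hk').hom.app x := by
  subst ha hb hk
  have := α.mul_assoc g₃ g₂ g₁ x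
  simp [mulIsoOf, eqToHom_app, this]

/-- The isomorphism `id ⇒ α_g α_{g⁻¹}`. -/
def invIso (g : G) : 𝟭 α.space ≅ (α.act g⁻¹).functor ⋙ (α.act g).functor :=
  α.unitIso ≪≫ (α.mulIsoOf (mul_inv_cancel g).symm).symm

theorem isUnitary_inv_app {H H' : TwoHilb.{v, u}} {F F' : H ⥤ H'} (τ : F ≅ F') {x : H}
    (h : IsUnitary (τ.hom.app x)) : IsUnitary (τ.inv.app x) := by
  rw [← h.dag_eq_inv (τ.hom_inv_id_app x)]
  exact h.dag

theorem invIso_unitary (g : G) (x : α.space) : IsUnitary ((α.invIso g).hom.app x) :=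
  (α.unit_unitary x).comp (isUnitary_inv_app _ (α.mulIsoOf_unitary _ x))

/-- The ambidextrous adjoint `α_{g⁻¹}` of `α_g`. -/
@[reducible]
noncomputable def actAdjoint (g : G) : AmbiAdjoint (α.act g) where
  adjoint := α.act g⁻¹
  -- As α_g is fully faithful, both adjunctions need only the isomorphism id ≅ α_g α_{g⁻¹}; no
  -- companion id ≅ α_{g⁻¹} α_g or triangle identity has to be supplied.
  asRight := Adjunction.mkOfHomEquiv
    { homEquiv := fun x y =>
        { toFun := fun f => (α.act g).functor.preimage (f ≫ (α.invIso g).hom.app y)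
          invFun := fun k => (α.act g).functor.map k ≫ (α.invIso g).inv.app y
          left_inv := fun f => by simp
          right_inv := fun k => (α.act g).functor.map_injective (by simp) }
      homEquiv_naturality_left_symm := fun f k => by simp
      homEquiv_naturality_right := fun f k => (α.act g).functor.map_injective (by
        have := (α.invIso g).hom.naturality k
        simp only [Functor.id_map, Functor.comp_map] at this
        simp [this]) }
  asLeft := Adjunction.mkOfHomEquiv
    { homEquiv := fun y x =>
        { toFun := fun k => (α.invIso g).hom.app y ≫ (α.act g).functor.map k
          invFun := fun f => (α.act g).functor.preimage ((α.invIso g).inv.app y ≫ f)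
          left_inv := fun k => (α.act g).functor.map_injective (by simp)
          right_inv := fun f => by simp }
      homEquiv_naturality_left_symm := fun f k => (α.act g).functor.map_injective (by
        have := (α.invIso g).inv.naturality f
        simp only [Functor.id_map, Functor.comp_map] at this
        simp [reassoc_of% this])
      homEquiv_naturality_right := fun f k => by simp }

theorem actAdjoint_unit_app (g : G) (y : α.space) :
    (α.actAdjoint g).asLeft.unit.app y = (α.invIso g).hom.app y := by
  simp [actAdjoint]

theorem actAdjoint_counit_app (g : G) (y : α.space) :
    (α.actAdjoint g).asRight.counit.app y = (α.invIso g).inv.app y := by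
  simp [actAdjoint]

/-- The counit of the right adjunction is inverse to the unit of the left one, and these are
unitary, so they are exchanged by the involution. As α_g is isometric, both sides become (k', k†),
where k' = φ(f). -/
theorem isEvenHanded_actAdjoint (g : G) : (α.actAdjoint g).IsEvenHanded := fun x y f k => by
  obtain ⟨k', rfl⟩ := ((α.actAdjoint g).asRight.homEquiv x y).symm.surjective f
  rw [Equiv.apply_symm_apply, Adjunction.homEquiv_counit, Adjunction.homEquiv_unit,
    actAdjoint_unit_app, actAdjoint_counit_app, dag_comp, ← (α.act g).map_dag,
    (α.invIso_unitary g y).dag_eq_inv ((α.invIso g).hom_inv_id_app y),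
    inn_comp_isUnitary_right _ _ (isUnitary_inv_app _ (α.invIso_unitary g y)), α.act_inner]

/-- The intertwiner `α_y α_g ⇒ α_k ⇒ α_g α_x` for `y g = k = g x`. -/
def conjIso {g x y k : G} (h : k = y * g) (h' : k = g * x) :
    (α.act g).functor ⋙ (α.act y).functor ≅ (α.act x).functor ⋙ (α.act g).functor :=
  α.mulIsoOf h ≪≫ (α.mulIsoOf h').symm

theorem twoCharTransport_app {g x y k : G} (h : y = g * x * g⁻¹) (hk : k = g * x)
    (hy : y = k * g⁻¹) (θ : 𝟭 α.space ⟶ (α.act x).functor) (X : α.space) :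
    (twoCharTransport α g h θ).app X = (α.invIso g).hom.app X ≫
      (α.act g).functor.map (θ.app ((α.act g⁻¹).functor.obj X)) ≫
        (α.mulIsoOf hk).hom.app ((α.act g⁻¹).functor.obj X) ≫ (α.mulIsoOf hy).hom.app X := by
  subst hk
  simp [twoCharTransport, invIso, mulIsoOf, eqToHom_app]

/-- This puts transport and χ(σ) on the same footing. The two composites differ only in how they
pass from α_k α_{g⁻¹} to α_y, and coherence for (y, g, g⁻¹) with the unit law at y identifies these.
-/
theorem twoCharTransport_eq {g x y k : G} (h : y = g * x * g⁻¹) (hk : k = g * x)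
    (hk' : k = y * g) (θ : 𝟭 α.space ⟶ (α.act x).functor) :
    twoCharTransport α g h θ = endCharMap (α.actAdjoint g) (α.conjIso hk' hk) θ := by
  ext X
  rw [α.twoCharTransport_app h hk (by rw [hk, h]), endCharMap_app, actAdjoint_unit_app,
    actAdjoint_counit_app]
  congr 2
  simp only [conjIso, Iso.trans_inv, Iso.symm_inv, NatTrans.comp_app, Category.assoc]
  congr 1
  -- Cancelling φ(y, g) on the left and the image of id ≅ α_g α_{g⁻¹} on the right leaves only
  -- isomorphisms to which associativity applies.
  rw [← cancel_epi ((α.mulIsoOf hk').hom.app _),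
    ← cancel_mono ((α.act y).functor.map ((α.invIso g).hom.app X))]
  have h1 := α.mulIsoOf_assoc hk' (mul_inv_cancel g).symm (k := y) (by rw [hk, h])
    (mul_one y).symm X
  have h2 := α.mulIsoOf_unit y X
  have h3 : (α.mulIsoOf (mul_one y).symm).hom.app X ≫
      (α.act y).functor.map (α.unitIso.hom.app X) = 𝟙 _ := by
    rw [← cancel_mono ((α.mulIsoOf (mul_one y).symm).hom.app X), Category.assoc, h2]
    simp
  rw [h1]
  simp only [Category.assoc, Iso.hom_inv_id_app_assoc, ← Functor.map_comp, Iso.inv_hom_id_app]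
  simp only [invIso, Iso.trans_hom, Iso.symm_hom, NatTrans.comp_app, Functor.map_comp]
  rw [reassoc_of% h3, ← Functor.map_comp, Iso.hom_inv_id_app]

end TwoRep

/-! ### Equivariance, invariance and functoriality of χ(σ) -/

namespace TwoRepHom

variable {G : Type w} [Group G] {α β : TwoRep.{v, u} G}

theorem mulIsoOf_compat (σ : TwoRepHom α β) {g₂ g₁ k : G} (h : k = g₂ * g₁) (x : α.space) :
    (β.mulIsoOf h).hom.app (σ.base.functor.obj x) ≫ (σ.iso k).hom.app x =
      (β.act g₂).functor.map ((σ.iso g₁).hom.app x) ≫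
        (σ.iso g₂).hom.app ((α.act g₁).functor.obj x) ≫
          σ.base.functor.map ((α.mulIsoOf h).hom.app x) := by
  subst h
  simp only [TwoRep.mulIsoOf_self]
  exact σ.mul_compat g₂ g₁ x

theorem twoCharMap_apply (σ : TwoRepHom α β) (A : AmbiAdjoint σ.base) (x : G)
    (θ : 𝟭 α.space ⟶ (α.act x).functor) :
    twoCharMap σ A x θ = endCharMap A (σ.iso x) θ := rfl

/-- The two sides are the maps induced by the composites β_g σ and σ α_g, which σ(g) identifies. -/
theorem twoCharMap_equivariant (σ : TwoRepHom α β) {A : AmbiAdjoint σ.base} (hA : A.IsEvenHanded)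
    {g x y : G} (h : y = g * x * g⁻¹) (θ : 𝟭 α.space ⟶ (α.act x).functor) :
    twoCharTransport β g h (twoCharMap σ A x θ) = twoCharMap σ A y (twoCharTransport α g h θ) := by
  have hk : g * x = y * g := by rw [h]; group
  rw [twoCharMap_apply, twoCharMap_apply, β.twoCharTransport_eq h rfl hk,
    α.twoCharTransport_eq h rfl hk]
  let κ₁ : (σ.base.comp (β.act g)).functor ⋙ (β.act y).functor ≅
      (α.act x).functor ⋙ (σ.base.comp (β.act g)).functor :=
    Functor.isoWhiskerLeft σ.base.functor (β.conjIso hk rfl) ≪≫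
      Functor.isoWhiskerRight (σ.iso x) (β.act g).functor
  let κ₂ : ((α.act g).comp σ.base).functor ⋙ (β.act y).functor ≅
      (α.act x).functor ⋙ ((α.act g).comp σ.base).functor :=
    Functor.isoWhiskerLeft (α.act g).functor (σ.iso y) ≪≫
      Functor.isoWhiskerRight (α.conjIso hk rfl) σ.base.functor
  have hβ := β.isEvenHanded_actAdjoint g
  have hα := α.isEvenHanded_actAdjoint g
  rw [← endCharMap_comp hA hβ (hA.comp hβ) (σ.iso x) (β.conjIso hk rfl) κ₁ (fun X => rfl),
    ← endCharMap_comp hα hA (hα.comp hA) (α.conjIso hk rfl) (σ.iso y) κ₂ (fun X => rfl)]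
  refine endCharMap_congr (hA.comp hβ) (hα.comp hA) _ _ (σ.iso g) (fun X => ?_) _
  -- That σ(g) respects the intertwiners amounts to equating two factorizations of σ(k), one from k
  -- = y g and one from k = g x.
  have h1 := σ.mulIsoOf_compat hk X
  have h2 := σ.mulIsoOf_compat (rfl : g * x = g * x) X
  have h4 : σ.base.functor.map ((α.mulIsoOf (rfl : g * x = g * x)).hom.app X) ≫
      σ.base.functor.map ((α.mulIsoOf (rfl : g * x = g * x)).inv.app X) = 𝟙 _ := by
    rw [← Functor.map_comp, Iso.hom_inv_id_app]
    exact σ.base.functor.map_id _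
  have h3 : (σ.iso (g * x)).hom.app X ≫
        σ.base.functor.map ((α.mulIsoOf (rfl : g * x = g * x)).inv.app X) =
      (β.mulIsoOf (rfl : g * x = g * x)).inv.app (σ.base.functor.obj X) ≫
        (β.act g).functor.map ((σ.iso x).hom.app X) ≫
          (σ.iso g).hom.app ((α.act x).functor.obj X) := by
    rw [← cancel_epi ((β.mulIsoOf (rfl : g * x = g * x)).hom.app (σ.base.functor.obj X)),
      reassoc_of% h2, h4, Iso.hom_inv_id_app_assoc]
    exact congrArg ((β.act g).functor.map ((σ.iso x).hom.app X) ≫ ·) (Category.comp_id _)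
  simp only [κ₁, κ₂, TwoRep.conjIso, Iso.trans_hom, Iso.symm_hom, NatTrans.comp_app,
    Functor.isoWhiskerLeft_hom, Functor.isoWhiskerRight_hom, Functor.whiskerLeft_app,
    Functor.whiskerRight_app, Functor.comp_obj, Functor.map_comp, Category.assoc] at h1 h3 ⊢
  rw [← h3, reassoc_of% h1]

/-- The 2-morphism equation is exactly the compatibility required by `endCharMap_congr`. With the
identity for i this is independence of the adjoint. -/
theorem twoCharMap_congr {σ ρ : TwoRepHom α β} (i : σ ≅ ρ) {A : AmbiAdjoint σ.base}
    {B : AmbiAdjoint ρ.base} (hA : A.IsEvenHanded) (hB : B.IsEvenHanded) (x : G) :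
    twoCharMap σ A x = twoCharMap ρ B x := by
  ext1 θ
  refine endCharMap_congr hA hB _ _ ⟨TwoRepModification.nat i.hom, TwoRepModification.nat i.inv,
    congrArg TwoRepModification.nat i.hom_inv_id,
    congrArg TwoRepModification.nat i.inv_hom_id⟩ (fun X => ?_) θ
  exact TwoRepModification.comm i.hom x X

theorem twoCharMap_id (α : TwoRep.{v, u} G) {A : AmbiAdjoint (TwoRepHom.id α).base}
    (hA : A.IsEvenHanded) (x : G) : twoCharMap (TwoRepHom.id α) A x = LinearMap.id := by
  ext1 θ
  exact endCharMap_id hA _ (fun X => id_iso_hom_app α x X) θ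

theorem twoCharMap_comp {γ : TwoRep.{v, u} G} (σ : TwoRepHom α β) (δ : TwoRepHom β γ)
    {A : AmbiAdjoint σ.base} {B : AmbiAdjoint δ.base} {C : AmbiAdjoint (σ.comp δ).base}
    (hA : A.IsEvenHanded) (hB : B.IsEvenHanded) (hC : C.IsEvenHanded) (x : G) :
    twoCharMap (σ.comp δ) C x = twoCharMap δ B x ∘ₗ twoCharMap σ A x := by
  ext1 θ
  exact endCharMap_comp hA hB hC (σ.iso x) (δ.iso x) _ (fun X => rfl) θ

end TwoRepHom

/-! ### Functoriality of the transport in the group element -/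

namespace TwoRep

variable {G : Type w} [Group G] (α : TwoRep.{v, u} G)

/-- The isomorphism φ(e) compares α_e with the identity functor, whose induced map is trivial; its
compatibility with the intertwiners is the two unit laws. -/
theorem twoCharTransport_one {x : G} (h : x = 1 * x * 1⁻¹)
    (θ : 𝟭 α.space ⟶ (α.act x).functor) : twoCharTransport α 1 h θ = θ := by
  rw [α.twoCharTransport_eq h (one_mul x).symm (mul_one x).symm]
  have hid := AmbiAdjoint.isEvenHanded_id α.space
  let κ : (LinStarFunctor.id α.space).functor ⋙ (α.act x).functor ≅
      (α.act x).functor ⋙ (LinStarFunctor.id α.space).functor :=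
    Functor.leftUnitor _ ≪≫ (Functor.rightUnitor _).symm
  have hκ : ∀ X, κ.hom.app X = 𝟙 _ := fun X => Category.id_comp _
  rw [← endCharMap_congr hid (α.isEvenHanded_actAdjoint 1) κ _ α.unitIso (fun X => ?_),
    endCharMap_id hid κ hκ]
  have h1 := α.unit_mulIsoOf x X
  have h2 := α.mulIsoOf_unit x X
  rw [hκ, ← cancel_mono ((α.mulIsoOf (one_mul x).symm).hom.app X)]
  simp only [conjIso, Iso.trans_hom, Iso.symm_hom, NatTrans.comp_app, Category.assoc,
    Iso.inv_hom_id_app]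
  rw [Category.comp_id, h2]
  exact (Category.id_comp _).trans h1

/-- Here φ(g₂, g₁) compares α_{g₂} α_{g₁} with α_{g₂g₁}. Compatibility uses associativity for the
triples (z, g₂, g₁), (g₂, g₁, x) and (g₂, y, g₁). -/
theorem twoCharTransport_mul {g₂ g₁ x y z : G} (h₁ : y = g₁ * x * g₁⁻¹) (h₂ : z = g₂ * y * g₂⁻¹)
    (h : z = g₂ * g₁ * x * (g₂ * g₁)⁻¹) (θ : 𝟭 α.space ⟶ (α.act x).functor) :
    twoCharTransport α (g₂ * g₁) h θ =
      twoCharTransport α g₂ h₂ (twoCharTransport α g₁ h₁ θ) := by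
  have e₁ : g₁ * x = y * g₁ := by rw [h₁]; group
  have e₂ : g₂ * y = z * g₂ := by rw [h₂]; group
  have e : g₂ * g₁ * x = z * (g₂ * g₁) := by rw [h]; group
  rw [α.twoCharTransport_eq h rfl e, α.twoCharTransport_eq h₁ rfl e₁,
    α.twoCharTransport_eq h₂ rfl e₂]
  have ev₁ := α.isEvenHanded_actAdjoint g₁
  have ev₂ := α.isEvenHanded_actAdjoint g₂
  let κ : ((α.act g₁).comp (α.act g₂)).functor ⋙ (α.act z).functor ≅
      (α.act x).functor ⋙ ((α.act g₁).comp (α.act g₂)).functor :=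
    Functor.isoWhiskerLeft (α.act g₁).functor (α.conjIso e₂ rfl) ≪≫
      Functor.isoWhiskerRight (α.conjIso e₁ rfl) (α.act g₂).functor
  rw [← endCharMap_comp ev₁ ev₂ (ev₁.comp ev₂) (α.conjIso e₁ rfl) (α.conjIso e₂ rfl) κ
    (fun X => rfl)]
  refine (endCharMap_congr (ev₁.comp ev₂) (α.isEvenHanded_actAdjoint (g₂ * g₁)) κ _
    (α.mulIso g₂ g₁) (fun X => ?_) θ).symm
  have a₁ := α.mulIsoOf_assoc e₂ (rfl : g₂ * g₁ = g₂ * g₁)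
    (show g₂ * g₁ * x = g₂ * y * g₁ by rw [h₁]; group) e X
  have a₂ := α.mulIsoOf_assoc (rfl : g₂ * g₁ = g₂ * g₁) (rfl : g₁ * x = g₁ * x)
    (rfl : g₂ * g₁ * x = g₂ * g₁ * x) (_root_.mul_assoc _ _ _) X
  have a₃ := α.mulIsoOf_assoc (rfl : g₂ * y = g₂ * y) e₁
    (show g₂ * g₁ * x = g₂ * y * g₁ by rw [h₁]; group) (_root_.mul_assoc _ _ _) X
  rw [← cancel_mono ((α.mulIsoOf (rfl : g₂ * g₁ * x = g₂ * g₁ * x)).hom.app X)]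
  rw [← α.mulIsoOf_self g₂ g₁]
  simp only [κ, conjIso, Iso.trans_hom, Iso.symm_hom, NatTrans.comp_app,
    Functor.isoWhiskerLeft_hom, Functor.isoWhiskerRight_hom, Functor.whiskerLeft_app,
    Functor.whiskerRight_app, Functor.comp_obj, Functor.map_comp, Category.assoc,
    Iso.inv_hom_id_app, Category.comp_id]
  rw [a₂, ← a₁, ← Category.assoc ((α.act g₂).functor.map ((α.mulIsoOf _).inv.app X)),
    ← Functor.map_comp, Iso.inv_hom_id_app, CategoryTheory.Functor.map_id, Category.id_comp,
    ← a₃, Iso.inv_hom_id_app_assoc]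

end TwoRep

/-! ### The inner product on natural transformations -/

namespace TwoHilb

variable {H H' : TwoHilb.{v, u}}

/-- Schur's lemma makes `i ≫ i†` a scalar c, and c = (i, i)/(id, id) > 0. Rescaling i by c^(-1/2)
gives an invertible isometry, hence a unitary. -/
theorem exists_unitary_of_iso {e s : H} [Simple e] (i : e ≅ s) : ∃ w : e ⟶ s, IsUnitary w := by
  obtain ⟨c, hc⟩ := endomorphism_simple_eq_smul_id ℂ (i.hom ≫ dag i.hom)
  have h1 : inn (𝟙 e) (i.hom ≫ dag i.hom) = inn i.hom i.hom := by
    rw [← inn_comp_left, Category.id_comp]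
  have he : inn (𝟙 e) (𝟙 e) ≠ 0 := fun h => id_nonzero e (inn_self_eq_zero h)
  have hi : inn i.hom i.hom ≠ 0 := fun h => id_nonzero e (by
    rw [← i.hom_inv_id, inn_self_eq_zero h, zero_comp])
  rw [← hc, inn_smul_right, ← inn_self_ofReal (𝟙 e), ← inn_self_ofReal i.hom] at h1
  rw [← inn_self_ofReal] at he hi
  have he' := lt_of_le_of_ne (inn_self_re_nonneg (𝟙 e)) fun h => he (by rw [← h]; rfl)
  have hi' := lt_of_le_of_ne (inn_self_re_nonneg i.hom) fun h => hi (by rw [← h]; rfl)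
  obtain ⟨r, hr, hcr⟩ : ∃ r : ℝ, 0 < r ∧ c = r :=
    ⟨_, div_pos hi' he', by rw [Complex.ofReal_div, eq_div_iff he, h1]⟩
  let d : ℝ := (√r)⁻¹
  have hd : (d : ℂ) * (d * c) = 1 := by
    rw [hcr, ← Complex.ofReal_mul, ← Complex.ofReal_mul, ← Complex.ofReal_one]
    congr 1
    have := Real.mul_self_sqrt hr.le
    have h0 : √r ≠ 0 := (Real.sqrt_pos.mpr hr).ne'
    simp only [d]
    field_simp
    rw [sq, this]
  let w := (d : ℂ) • i.hom
  have hw : w ≫ dag w = 𝟙 e := by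
    simp only [w, dag_smul, Complex.conj_ofReal, Linear.smul_comp, Linear.comp_smul, ← hc,
      smul_smul, hd, one_smul]
  have hd0 : (d : ℂ) ≠ 0 := fun h => by simp [h] at hd
  refine ⟨w, hw, ?_⟩
  have hw' : ((d : ℂ)⁻¹ • i.inv) ≫ w = 𝟙 s := by
    simp only [w, Linear.smul_comp, Linear.comp_smul, smul_smul, mul_inv_cancel₀ hd0, one_smul,
      i.inv_hom_id]
  have : dag w = (d : ℂ)⁻¹ • i.inv := by
    rw [← Category.id_comp (dag w), ← hw', Category.assoc, hw, Category.comp_id]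
  rw [this, hw']

/-- The summands of the inner product of natural transformations do not depend on the choice of
simple objects. -/
theorem inn_id_mul_inn_app_eq {F F' : LinStarFunctor H H'} (θ θ' : F.functor ⟶ F'.functor)
    {e s : H} [Simple e] (i : e ≅ s) :
    inn (𝟙 e) (𝟙 e) * inn (θ.app e) (θ'.app e) = inn (𝟙 s) (𝟙 s) * inn (θ.app s) (θ'.app s) := by
  obtain ⟨w, hw⟩ := exists_unitary_of_iso i
  have h1 : inn (𝟙 e) (𝟙 e) = inn (𝟙 s) (𝟙 s) := by
    rw [← inn_comp_isUnitary_right _ _ hw, ← inn_comp_isUnitary_left hw (𝟙 s),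
      Category.id_comp, Category.comp_id]
  rw [h1, ← inn_comp_isUnitary_right _ _ (hw.map F'), ← θ.naturality, ← θ'.naturality,
    inn_comp_isUnitary_left (hw.map F)]

theorem nat_ext_simpleRep {F F' : LinStarFunctor H H'} {θ θ' : F.functor ⟶ F'.functor}
    (h : ∀ i : SimpleClass H, θ.app (simpleRep i) = θ'.app (simpleRep i)) : θ = θ' := by
  ext x
  refine map_comp_ext F fun i b => ?_
  rw [θ.naturality, θ'.naturality, h]

theorem finiteDimensional_nat (F F' : LinStarFunctor H H') :
    FiniteDimensional ℂ (F.functor ⟶ F'.functor) := by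
  let L : (F.functor ⟶ F'.functor) →ₗ[ℂ]
      (∀ i : SimpleClass H, F.functor.obj (simpleRep i) ⟶ F'.functor.obj (simpleRep i)) :=
    { toFun := fun θ i => θ.app (simpleRep i)
      map_add' := fun _ _ => rfl
      map_smul' := fun _ _ => rfl }
  exact FiniteDimensional.of_injective L fun θ θ' h => nat_ext_simpleRep fun i => congrFun h i

theorem natInner_self_re {F F' : LinStarFunctor H H'} (θ : F.functor ⟶ F'.functor) :
    (natInner θ θ).re =
      ∑ i, (scale i).re * (inn (θ.app (simpleRep i)) (θ.app (simpleRep i))).re := by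
  rw [natInner, Complex.re_sum]
  refine Finset.sum_congr rfl fun i _ => ?_
  rw [← scale_ofReal, Complex.re_ofReal_mul, Complex.ofReal_re]

/-- The inner product of natural transformations makes `Nat(F, F')` a Hilbert space. -/
@[reducible]
noncomputable def natInnerCore (F F' : LinStarFunctor H H') :
    InnerProductSpace.Core ℂ (F.functor ⟶ F'.functor) where
  inner θ θ' := natInner θ θ'
  conj_inner_symm θ θ' := by
    simp only [natInner, map_sum, map_mul, scale_conj, inn_conj_symm]
  re_inner_nonneg θ := by
    change 0 ≤ (natInner θ θ).re
    rw [natInner_self_re]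
    exact Finset.sum_nonneg fun i _ => mul_nonneg (scale_re_pos i).le (inn_self_re_nonneg _)
  add_left θ θ' θ'' := by
    simp only [natInner, NatTrans.app_add, inn_add_left, mul_add, Finset.sum_add_distrib]
  smul_left θ θ' c := by
    simp only [natInner, NatTrans.app_smul, inn_smul_left, Finset.mul_sum, mul_left_comm]
  definite θ h := by
    have h0 : (natInner θ θ).re = 0 := congrArg Complex.re h
    rw [natInner_self_re, Finset.sum_eq_zero_iff_of_nonneg
      fun i _ => mul_nonneg (scale_re_pos i).le (inn_self_re_nonneg _)] at h0
    refine nat_ext_simpleRep fun i => inn_self_eq_zero ?_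
    have := (mul_eq_zero.mp (h0 i (Finset.mem_univ i))).resolve_left (scale_re_pos i).ne'
    rw [← inn_self_ofReal, this, Complex.ofReal_zero]

end TwoHilb

/-! ### The 2-character as a functor -/

namespace TwoRep

variable {G : Type w} [Group G] (α : TwoRep.{v, u} G)

instance (g : G) : (α.act g).functor.EssSurj :=
  ⟨fun y => ⟨(α.act g⁻¹).functor.obj y, ⟨((α.invIso g).app y).symm⟩⟩⟩

instance (g : G) : (α.act g).functor.IsEquivalence where

instance (g : G) (i : SimpleClass α.space) : Simple ((α.act g).functor.obj (simpleRep i)) :=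
  simple_obj _ _

/-- A fully faithful functor reflects isomorphism, so the map is injective on a finite set. -/
theorem simpleClass_act_bijective (g : G) :
    Function.Bijective fun i : SimpleClass α.space =>
      simpleClass ((α.act g).functor.obj (simpleRep i)) := by
  refine Finite.injective_iff_bijective.mp fun i j hij => ?_
  obtain ⟨a⟩ := nonempty_iso_simpleRep ((α.act g).functor.obj (simpleRep i))
  obtain ⟨b⟩ := nonempty_iso_simpleRep ((α.act g).functor.obj (simpleRep j))
  exact eq_of_simpleRep_iso ((α.act g).functor.preimageIso
    (a.symm ≪≫ eqToIso (congrArg simpleRep hij) ≪≫ b))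

/-- At e_i the transported θ is α_g of the component of θ at α_{g⁻¹} e_i, up to unitaries. The
isometry α_g removes itself, so the sum is the original one reindexed by the permutation i ↦
[α_{g⁻¹} e_i]. -/
theorem natInner_twoCharTransport {g x y : G} (h : y = g * x * g⁻¹)
    (θ θ' : 𝟭 α.space ⟶ (α.act x).functor) :
    natInner (twoCharTransport α g h θ) (twoCharTransport α g h θ') = natInner θ θ' := by
  have hsum := (α.simpleClass_act_bijective g⁻¹).sum_comp fun j : SimpleClass α.space =>
    scale j * inn (θ.app (simpleRep j)) (θ'.app (simpleRep j))
  refine Eq.trans (Finset.sum_congr rfl fun i _ => ?_) hsum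
  obtain ⟨a⟩ := nonempty_iso_simpleRep ((α.act g⁻¹).functor.obj (simpleRep i))
  have h1 := inn_id_mul_inn_app_eq (F := LinStarFunctor.id α.space) (F' := α.act x) θ θ' a
  refine Eq.trans ?_ h1.symm
  -- The weight is preserved because α_{g⁻¹} is isometric.
  have h2 : inn (𝟙 ((α.act g⁻¹).functor.obj (simpleRep i)))
      (𝟙 ((α.act g⁻¹).functor.obj (simpleRep i))) = scale i := by
    rw [← CategoryTheory.Functor.map_id, α.act_inner]
    rfl
  rw [h2, α.twoCharTransport_app h rfl h, α.twoCharTransport_app h rfl h,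
    inn_comp_isUnitary_left (α.invIso_unitary g _),
    inn_comp_isUnitary_right _ _ ((α.mulIsoOf_unitary _ _).comp (α.mulIsoOf_unitary _ _)),
    α.act_inner]

theorem twoChar_isUnitaryBundle : (twoChar α).IsUnitaryBundle where
  finite x := finiteDimensional_nat (LinStarFunctor.id α.space) (α.act x)
  inner x := ⟨natInnerCore (LinStarFunctor.id α.space) (α.act x), fun _ _ => rfl⟩
  act_one _ h := LinearMap.ext fun θ => α.twoCharTransport_one h θ
  act_mul _ _ _ _ _ h₁ h₂ h := LinearMap.ext fun θ => α.twoCharTransport_mul h₁ h₂ h θ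
  act_form _ _ _ h θ θ' := α.natInner_twoCharTransport h θ θ'

/-- The 2-character as a unitary equivariant vector bundle. -/
noncomputable def character : HilbG.{max u v} G := ⟨twoChar α, α.twoChar_isUnitaryBundle⟩

end TwoRep

namespace TwoRepHom

variable {G : Type w} [Group G] {α β : TwoRep.{v, u} G}

/-- The morphism of equivariant vector bundles induced by a morphism of 2-representations and an
even-handed adjoint of it. -/
def bundleHom (σ : TwoRepHom α β) (A : AmbiAdjoint σ.base) (hA : A.IsEvenHanded) :
    α.character ⟶ β.character :=
  HilbGHom.mk (E := α.character) (E' := β.character) (fun x => twoCharMap σ A x)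
    fun _ _ _ h => LinearMap.ext fun θ => σ.twoCharMap_equivariant hA h θ

/-- The morphism of equivariant vector bundles induced by a morphism of 2-representations. -/
noncomputable def characterMap (σ : TwoRepHom α β) : α.character ⟶ β.character :=
  σ.bundleHom (AmbiAdjoint.exists_isEvenHanded σ.base).choose
    (AmbiAdjoint.exists_isEvenHanded σ.base).choose_spec

theorem characterMap_eq (σ : TwoRepHom α β) {A : AmbiAdjoint σ.base} (hA : A.IsEvenHanded) :
    σ.characterMap = σ.bundleHom A hA :=
  HilbGHom.ext (funext fun x => twoCharMap_congr (Iso.refl σ)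
    (AmbiAdjoint.exists_isEvenHanded σ.base).choose_spec hA x)

end TwoRepHom

/-- The 2-character as a functor on the homotopy category of unitary 2-representations. -/
noncomputable def characterFunctor (G : Type w) [Group G] :
    HoTwoRep.{v, u} G ⥤ HilbG.{max u v} G where
  obj a := a.rep.character
  map {a b} f := Quotient.lift (fun σ : TwoRepHom a.rep b.rep => σ.characterMap)
    (fun σ ρ h => HilbGHom.ext (funext fun x =>
      TwoRepHom.twoCharMap_congr (Classical.choice h) (AmbiAdjoint.exists_isEvenHanded _).choose_spec
        (AmbiAdjoint.exists_isEvenHanded _).choose_spec x)) f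
  map_id a := HilbGHom.ext (funext fun x =>
    TwoRepHom.twoCharMap_id a.rep (AmbiAdjoint.exists_isEvenHanded _).choose_spec x)
  map_comp := by
    rintro a b c ⟨σ⟩ ⟨δ⟩
    exact HilbGHom.ext (funext fun x => TwoRepHom.twoCharMap_comp σ δ
      (AmbiAdjoint.exists_isEvenHanded _).choose_spec
      (AmbiAdjoint.exists_isEvenHanded _).choose_spec
      (AmbiAdjoint.exists_isEvenHanded _).choose_spec x)

theorem mainTheorem4 (G : Type w) [Group G] [Finite G] :
    -- every morphism of unitary 2-representations has an even-handed ambidextrous adjoint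
    (∀ (α β : TwoRep.{v, u} G) (σ : TwoRepHom α β),
      ∃ A : AmbiAdjoint σ.base, A.IsEvenHanded) ∧
    -- (i) independence of the choice of the even-handed adjoint
    (∀ (α β : TwoRep.{v, u} G) (σ : TwoRepHom α β) (A A' : AmbiAdjoint σ.base),
      A.IsEvenHanded → A'.IsEvenHanded → ∀ x : G, twoCharMap σ A x = twoCharMap σ A' x) ∧
    -- (ii) equivariance
    (∀ (α β : TwoRep.{v, u} G) (σ : TwoRepHom α β) (A : AmbiAdjoint σ.base),
      A.IsEvenHanded → ∀ (g x y : G) (h : y = g * x * g⁻¹),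
        (twoChar β).act g h ∘ₗ twoCharMap σ A x = twoCharMap σ A y ∘ₗ (twoChar α).act g h) ∧
    -- (iii) dependence only on the isomorphism class
    (∀ (α β : TwoRep.{v, u} G) (σ ρ : TwoRepHom α β), Nonempty (σ ≅ ρ) →
      ∀ (A : AmbiAdjoint σ.base) (B : AmbiAdjoint ρ.base), A.IsEvenHanded → B.IsEvenHanded →
        ∀ x : G, twoCharMap σ A x = twoCharMap ρ B x) ∧
    -- (iv) functoriality
    (∀ (α : TwoRep.{v, u} G) (A : AmbiAdjoint (TwoRepHom.id α).base), A.IsEvenHanded →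
      ∀ x : G, twoCharMap (TwoRepHom.id α) A x = LinearMap.id) ∧
    (∀ (α β γ : TwoRep.{v, u} G) (σ : TwoRepHom α β) (δ : TwoRepHom β γ)
      (A : AmbiAdjoint σ.base) (B : AmbiAdjoint δ.base) (C : AmbiAdjoint (σ.comp δ).base),
      A.IsEvenHanded → B.IsEvenHanded → C.IsEvenHanded →
        ∀ x : G, twoCharMap (σ.comp δ) C x = twoCharMap δ B x ∘ₗ twoCharMap σ A x) ∧
    -- hence the 2-character is a functor from the homotopy category to `Hilb_G(G)`
    ∃ (hχ : ∀ α : TwoRep.{v, u} G, (twoChar α).IsUnitaryBundle)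
      (χ : HoTwoRep.{v, u} G ⥤ HilbG.{max u v} G)
      (hobj : ∀ α : TwoRep.{v, u} G, χ.obj ⟨α⟩ = ⟨twoChar α, hχ α⟩),
      ∀ (α β : TwoRep.{v, u} G) (σ : TwoRepHom α β) (A : AmbiAdjoint σ.base),
        A.IsEvenHanded →
          ∃ m : (⟨twoChar α, hχ α⟩ : HilbG.{max u v} G) ⟶ ⟨twoChar β, hχ β⟩,
            (∀ x : G, HilbGHom.app m x = twoCharMap σ A x) ∧
            χ.map (HoTwoRep.homMk σ) =
              eqToHom (hobj α) ≫ m ≫ eqToHom (hobj β).symm := by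
  refine ⟨fun α β σ => AmbiAdjoint.exists_isEvenHanded σ.base,
    fun α β σ A A' hA hA' x => TwoRepHom.twoCharMap_congr (Iso.refl σ) hA hA' x,
    fun α β σ A hA g x y h => LinearMap.ext fun θ => σ.twoCharMap_equivariant hA h θ,
    fun α β σ ρ ⟨i⟩ A B hA hB x => TwoRepHom.twoCharMap_congr i hA hB x,
    fun α A hA x => TwoRepHom.twoCharMap_id α hA x,
    fun α β γ σ δ A B C hA hB hC x => TwoRepHom.twoCharMap_comp σ δ hA hB hC x,
    fun α => α.twoChar_isUnitaryBundle, characterFunctor G, fun α => rfl,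
    fun α β σ A hA => ⟨σ.bundleHom A hA, fun x => rfl, ?_⟩⟩
  refine (σ.characterMap_eq hA).trans ?_
  -- The object identification holds definitionally, so both `eqToHom`s are identities.
  exact ((Category.id_comp _).trans (Category.comp_id _)).symm
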